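/- **Setting.** For $\gamma\in\mathbb R$ and $K\ge 1$ let $P_K(\gamma)=\exp\!\big(i\gamma\,|1\cdots1\rangle\langle1\cdots1|\big)$ be the $K$-qubit phase gate. A *lattice-surgery circuit* on $K$ data qubits and $A$ ancilla qubits starts with the data qubits in an arbitrary state and the ancillas in a product of $|0\rangle$, $|+\rangle$ and three-qubit CCZ states $|\mathrm{CCZ}\rangle=\mathrm{CCZ}|{+}{+}{+}\rangle$ (the qubits of the CCZ states are counted among the $A$ ancillas). It then performs a sequence of instructions: classically controlled single-qubit Pauli gates; single-qubit Pauli measurements; layers of simultaneous two-qubit Pauli measurements on pairwise disjoint pairs of qubits; two-input Boolean gates on classical bits; and single-qubit phase gates $P_1(\gamma)$. Measurements may be adaptive: whether and in which Pauli basis they are performed may depend on a classical bit that is known when they start. A *logical cycle* is the time of a two-qubit Pauli measurement; a layer of such measurements thus takes one logical cycle, $P_1(\gamma)$ takes $n_P$ logical cycles, and single-qubit Pauli gates, single-qubit Pauli measurements and classical processing take no time; the durations of successive instructions add up. A circuit $V$ is *$Z$-equivalent* to a unitary $U$ on the data qubits if, for all measurement outcomes, the action of $V$ followed by single-qubit Pauli-$Z$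 corrections of the data qubits, which are computed from the measurement outcomes by the classical instructions of $V$, equals the action of $U$ on the data qubits (the ancillas being left in a state that does not depend on the data). **Theorem.** There is a polynomial $p$ such that for every $K\ge2$ there is a lattice-surgery circuit $V$ on $K$ data qubits and $\lfloor\frac{13}{2}K\rfloor$ ancilla qubits, the same for all $\gamma$ and $n_P$, with the following properties. 1. For every $\gamma\in\mathbb R$, $V$ with the phase gate $P_1(\gamma)$ is $Z$-equivalent to $P_K(\gamma)$. 2. $V$ addresses the $K$ data qubits (before the Pauli-$Z$ corrections) during one logical cycle only. 3. $V$ consumes $$\sum_{\ell=1}^{\lceil\log_2K\rceil}\Big\lfloor\tfrac12\big\lceil K/2^{\ell-1}\big\rceil\Big\rfloor=K-1$$ CCZ states; if $K$ is a power of two, this number is $\sum_{\ell=1}^{\lceil\log_2K\rceil}\lfloor K/2^\ell\rfloor$. 4. If $P_1(\gamma)$ takes $n_P$ logical cycles, then $V$ takes $n_P+4\lceil\log_2K\rceil$ logical cycles in total. 5. The measurement bases and the Pauli-$Z$ corrections are efficiently computed from the measurement outcomes: $V$ consists of at most $p(K)$ elementary quantum and classical operations. -/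

import Mathlib

/-! Lattice-surgery circuits: single-qubit Pauli gates, adaptive one- and two-qubit Pauli
measurements, ancillas prepared in `|0⟩`, `|+⟩` and CCZ states, and the single-qubit phase gate. -/

namespace LatticeSurgery

/-- The `K`-qubit phase gate `P_K(γ) = exp(i γ |1…1⟩⟨1…1|)`, in the computational basis. -/
noncomputable def phaseGate (K : ℕ) (γ : ℝ) : Matrix (Fin K → Bool) (Fin K → Bool) ℂ :=
  NormedSpace.exp ((Complex.I * (γ : ℂ)) •
    Matrix.single (fun _ : Fin K => true) (fun _ : Fin K => true) (1 : ℂ))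

/-- `P_K(γ)` is diagonal: it multiplies `|1…1⟩` by `e^{iγ}` and fixes the other basis states. -/
theorem phaseGate_eq_diagonal (K : ℕ) (γ : ℝ) :
    phaseGate K γ = Matrix.diagonal
      (fun x => if x = (fun _ => true) then Complex.exp (Complex.I * γ) else 1) := by
  have h : (Complex.I * (γ : ℂ)) •
      Matrix.single (fun _ : Fin K => true) (fun _ : Fin K => true) (1 : ℂ) =
      Matrix.diagonal (fun x => if x = (fun _ => true) then Complex.I * γ else 0) := by
    ext x y
    by_cases hxy : x = y
    · subst hxy
      by_cases hx : x = fun _ => true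
      · simp [hx]
      · simp [hx, Ne.symm hx]
    · rw [Matrix.diagonal_apply_ne _ hxy, Matrix.smul_apply, Matrix.single_apply, if_neg]
      · simp
      · rintro ⟨rfl, rfl⟩
        exact hxy rfl
  rw [phaseGate, h, Matrix.exp_diagonal]
  congr 1
  funext x
  rw [Pi.coe_exp, ← Complex.exp_eq_exp_ℂ]
  split_ifs <;> simp

/-- A (not necessarily normalized) state vector of qubits labelled by `Q`. -/
abbrev State (Q : Type) := (Q → Bool) → ℂ

/-- The single-qubit Pauli operators. -/
inductive Pauli
  | X
  | Y
  | Z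

section Semantics

variable {Q B : Type} [DecidableEq Q] [DecidableEq B]

/-- The Pauli operator `P` acting on the qubit `q`. -/
noncomputable def Pauli.act (P : Pauli) (q : Q) (ψ : State Q) : State Q := fun x =>
  match P with
  | .X => ψ (Function.update x q (!x q))
  | .Y => (if x q then Complex.I else -Complex.I) * ψ (Function.update x q (!x q))
  | .Z => (if x q then -1 else 1) * ψ x

/-- The orthogonal projection `(1 + (-1)^b T) / 2` onto the `(-1)^b`-eigenspace of an involution
`T`: the effect of measuring `T` with outcome `b`, without renormalization. -/
noncomputable def outcomeProj (T : State Q → State Q) (b : Bool) (ψ : State Q) : State Q :=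
  fun x => (ψ x + (if b then -1 else 1) * T ψ x) / 2

/-- The single-qubit phase gate `P_1(γ)` acting on the qubit `q`. -/
noncomputable def phaseAct (γ : ℝ) (q : Q) (ψ : State Q) : State Q := fun x =>
  (if x q then Complex.exp (Complex.I * γ) else 1) * ψ x

/-- An adaptive two-qubit Pauli measurement. If the classical bit `ctrl` has value `c`, then
`P₁ ⊗ P₂` is measured when `basis c = some (P₁, P₂)`, and nothing is done when `basis c = none`.
The outcome is stored in the classical bit `out`. -/
structure PairMeas (Q B : Type) where
  fst : Q
  snd : Q
  basis : Bool → Option (Pauli × Pauli)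
  ctrl : B
  out : B

/-- The instructions of a lattice-surgery circuit on qubits `Q` with classical bits `B`.
* `gate P q ctrl`: apply the Pauli gate `P` to `q` if the bit `ctrl` is `true`;
* `meas q basis ctrl out`: if `ctrl` has value `c` and `basis c = some P`, then measure `P` on `q`
  and store the outcome in `out`; do nothing if `basis c = none`;
* `logic f a b out`: classical processing, the bit `out` is set to `f a b`;
* `merge ms`: perform the two-qubit measurements `ms` simultaneously;
* `phase q`: apply the single-qubit phase gate `P_1(γ)` to `q`. -/
inductive Op (Q B : Type)
  | gate (P : Pauli) (q : Q) (ctrl : B)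
  | meas (q : Q) (basis : Bool → Option Pauli) (ctrl out : B)
  | logic (f : Bool → Bool → Bool) (a b out : B)
  | merge (ms : List (PairMeas Q B))
  | phase (q : Q)

/-- The qubits that an instruction addresses (with multiplicity). -/
def Op.qubits : Op Q B → List Q
  | .gate _ q _ => [q]
  | .meas q _ _ _ => [q]
  | .logic _ _ _ _ => []
  | .merge ms => ms.flatMap fun p => [p.fst, p.snd]
  | .phase q => [q]

/-- The classical bits that an instruction writes. -/
def Op.writes : Op Q B → List B
  | .gate _ _ _ => []
  | .meas _ _ _ out => [out]
  | .logic _ _ _ out => [out]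
  | .merge ms => ms.map PairMeas.out
  | .phase _ => []

/-- Duration in logical cycles, one cycle being the duration of a two-qubit Pauli measurement;
`nP` is the number of logical cycles taken by `P_1(γ)`. Single-qubit Pauli gates, single-qubit
Pauli measurements and classical processing take no time. -/
def Op.cycles (nP : ℕ) : Op Q B → ℕ
  | .gate _ _ _ => 0
  | .meas _ _ _ _ => 0
  | .logic _ _ _ _ => 0
  | .merge _ => 1
  | .phase _ => nP

/-- Number of elementary (quantum or classical) operations in an instruction. -/
def Op.size : Op Q B → ℕ
  | .merge ms => ms.length
  | _ => 1

/-- Effect of a two-qubit measurement on the state, if the classical bits have the values `m` when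
the measurement starts and its outcome is `ω out`. -/
noncomputable def PairMeas.project (ω m : B → Bool) (p : PairMeas Q B) (ψ : State Q) : State Q :=
  match p.basis (m p.ctrl) with
  | none => ψ
  | some (P₁, P₂) => outcomeProj (fun φ => P₁.act p.fst (P₂.act p.snd φ)) (ω p.out) ψ

/-- Effect of a two-qubit measurement on the current values `m'` of the classical bits, if these
had the values `m` when the measurement started. -/
def PairMeas.record (ω m : B → Bool) (p : PairMeas Q B) (m' : B → Bool) : B → Bool :=
  match p.basis (m p.ctrl) with
  | none => m'
  | some _ => Function.update m' p.out (ω p.out)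

/-- Effect of one instruction on the state and the classical bits, in the branch in which the
measurement that writes to the bit `c` has outcome `ω c`. -/
noncomputable def Op.run (γ : ℝ) (ω : B → Bool) :
    Op Q B → State Q × (B → Bool) → State Q × (B → Bool)
  | .gate P q ctrl, (ψ, m) => (if m ctrl then P.act q ψ else ψ, m)
  | .meas q basis ctrl out, (ψ, m) =>
    match basis (m ctrl) with
    | none => (ψ, m)
    | some P => (outcomeProj (P.act q) (ω out) ψ, Function.update m out (ω out))
  | .logic f a b out, (ψ, m) => (ψ, Function.update m out (f (m a) (m b)))
  | .merge ms, (ψ, m) =>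
    (ms.foldl (fun φ p => p.project ω m φ) ψ, ms.foldl (fun m' p => p.record ω m m') m)
  | .phase q, (ψ, m) => (phaseAct γ q ψ, m)

end Semantics

/-- The product state of data qubits in state `ψ` and ancilla qubits in state `φ`. -/
def tensor {K A : ℕ} (ψ : State (Fin K)) (φ : State (Fin A)) : State (Fin K ⊕ Fin A) :=
  fun x => ψ (fun i => x (.inl i)) * φ (fun a => x (.inr a))

/-- The amplitudes of the state `|CCZ⟩ = CCZ |+++⟩`. -/
noncomputable def cczAmp (a b c : Bool) : ℂ :=
  (if a && b && c then -1 else 1) / (Real.sqrt 8 : ℂ)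

/-- A lattice-surgery circuit on `K` data qubits and `A` ancilla qubits. -/
structure Circuit (K A : ℕ) where
  /-- the number of CCZ states that are consumed -/
  numCCZ : ℕ
  /-- the (pairwise distinct) ancillas that hold the qubits of the CCZ states at the start -/
  ccz : Fin numCCZ × Fin 3 ↪ Fin A
  /-- of the remaining ancillas, those in `plus` start in `|+⟩`, all others in `|0⟩` -/
  plus : Finset (Fin A)
  /-- the instructions, in chronological order -/
  ops : List (Op (Fin K ⊕ Fin A) ℕ)
  /-- the data qubit `i` needs a Pauli-`Z` correction iff the classical bit `corr i` is `true` at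
  the end -/
  corr : Fin K → ℕ
  /-- every classical bit is written at most once (so distinct measurements have distinct outcome
  bits) -/
  writes_nodup : (ops.flatMap Op.writes).Nodup
  /-- simultaneous two-qubit measurements address disjoint pairs of distinct qubits -/
  merge_disjoint : ∀ ms, Op.merge ms ∈ ops → (Op.merge ms).qubits.Nodup

namespace Circuit

variable {K A : ℕ} (V : Circuit K A)

/-- The initial state of the ancilla qubits. -/
noncomputable def ancillaState : State (Fin A) := fun y =>
  (∏ j, cczAmp (y (V.ccz (j, 0))) (y (V.ccz (j, 1))) (y (V.ccz (j, 2)))) *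
    ∏ a ∈ (Finset.univ.map V.ccz)ᶜ,
      if a ∈ V.plus then 1 / (Real.sqrt 2 : ℂ) else if y a then 0 else 1

/-- State and classical bits at the end of the circuit, in the branch with measurement outcomes `ω`,
for the initial data state `ψ`. All classical bits are initially `false`. -/
noncomputable def run (γ : ℝ) (ω : ℕ → Bool) (ψ : State (Fin K)) :
    State (Fin K ⊕ Fin A) × (ℕ → Bool) :=
  V.ops.foldl (fun c o => o.run γ ω c) (tensor ψ V.ancillaState, fun _ => false)

/-- The final state after the Pauli-`Z` corrections of the data qubits. -/
noncomputable def correctedOutput (γ : ℝ) (ω : ℕ → Bool) (ψ : State (Fin K)) :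
    State (Fin K ⊕ Fin A) := fun x =>
  (∏ i, if (V.run γ ω ψ).2 (V.corr i) && x (.inl i) then (-1 : ℂ) else 1) * (V.run γ ω ψ).1 x

/-- `V`, with `P_1(γ)` as its phase gate, is `Z`-equivalent to `U`: for all measurement outcomes,
`V` followed by the Pauli-`Z` corrections maps every data state `ψ` to `U ψ`, leaving the ancillas
in a state `φ` that does not depend on `ψ` (unnormalized; `‖φ‖²` is the probability of the
outcomes). -/
def ZEquivalent (γ : ℝ) (U : Matrix (Fin K → Bool) (Fin K → Bool) ℂ) : Prop :=
  ∀ ω : ℕ → Bool, ∃ φ : State (Fin A), ∀ ψ : State (Fin K),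
    V.correctedOutput γ ω ψ = tensor (U.mulVec ψ) φ

/-- The data qubits are addressed during a single logical cycle (of two-qubit measurements) only. -/
def AddressesDataForOneCycle : Prop :=
  ∃ pre ms post, V.ops = pre ++ Op.merge ms :: post ∧
    ∀ o ∈ pre ++ post, ∀ i : Fin K, Sum.inl i ∉ o.qubits

/-- The total number of logical cycles, if `P_1(γ)` takes `nP` logical cycles. -/
def cycles (nP : ℕ) : ℕ := (V.ops.map (Op.cycles nP)).sum

/-- The total number of elementary quantum and classical operations. The classical ones include
all that is needed to compute the measurement bases and the corrections from the outcomes. -/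
def size : ℕ := (V.ops.map Op.size).sum

end Circuit

end LatticeSurgery

namespace LatticeSurgery

/-! The value of the conjunction of the data bits is computed by a tree of `AND` gates: node `j` has
the children `2 * j` and `2 * j + 1`, the nodes from `K` to `2 * K - 1` are the leaves, and `1` is
the root. Each internal node holds one CCZ state, whose first two qubits stand for its children and
whose third one is the product of their values. The outcome of each measurement that attaches a
qubit to another one leaves a Pauli `X`, the frame of a node. Inverting the inputs of a product
changes it by linear terms, so the `X` of the children of `j` turn into linear terms at `j`. These
are supplied by the measurements that erase the third qubit and a copy of it, in the basis `X` or
`X ⊗ Z` depending on the frames of the children. Thus an exact product up to a single new frame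
arrives at `j`, and at the root `P_1(γ)` acts on the conjunction.

On the way down, measuring a node in the `X` basis may leave the sign `(-1)^(value of the node)`,
that is, a controlled `Z` between its children. Erasing one child in the basis `X` or `X ⊗ Z`
replaces it by signs at the children, and the signs at the leaves are the Pauli-`Z` corrections.

Instructions at unrelated nodes commute, so each level takes three cycles on the way up (one more
coupling, to the data qubits, is simultaneous with the first of them) and one on the way down. -/

/-! ### Instructions as local operators -/

section Operators

variable {Q B : Type}

section Pauli

variable [DecidableEq Q]

/-- The Pauli operator `P` on the qubit `q`, as an element of the algebra of operators. -/
noncomputable def Pauli.op (P : Pauli) (q : Q) : Module.End ℂ (State Q) where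
  toFun := P.act q
  map_add' ψ φ := by cases P <;> ext x <;> simp [Pauli.act, mul_add]
  map_smul' c ψ := by cases P <;> ext x <;> simp [Pauli.act, mul_left_comm]

theorem Pauli.op_apply (P : Pauli) (q : Q) (ψ : State Q) : P.op q ψ = P.act q ψ := rfl

theorem Pauli.op_commute (P P' : Pauli) {q q' : Q} (h : q ≠ q') :
    Commute (P.op q) (P'.op q') := by
  refine LinearMap.ext fun ψ => ?_
  simp only [Module.End.mul_apply, Pauli.op_apply]
  cases P <;> cases P' <;> ext x <;>
    simp only [Pauli.act, Function.update_of_ne h, Function.update_of_ne h.symm,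
      Function.update_comm h] <;> ring

/-- The algebra of operators that act on the qubits in `S` only. -/
noncomputable def localOps (S : Set Q) : Subalgebra ℂ (Module.End ℂ (State Q)) :=
  Algebra.adjoin ℂ {T | ∃ (P : Pauli) (q : Q), q ∈ S ∧ T = P.op q}

theorem Pauli.op_mem_localOps (P : Pauli) {q : Q} {S : Set Q} (h : q ∈ S) :
    P.op q ∈ localOps S :=
  Algebra.subset_adjoin ⟨P, q, h, rfl⟩

theorem commute_of_mem_localOps {S S' : Set Q} (h : Disjoint S S')
    {T T' : Module.End ℂ (State Q)} (hT : T ∈ localOps S) (hT' : T' ∈ localOps S') :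
    Commute T T' := by
  refine Algebra.commute_of_mem_adjoin_of_forall_mem_commute hT' ?_
  rintro _ ⟨P', q', hq', rfl⟩
  refine (Algebra.commute_of_mem_adjoin_of_forall_mem_commute hT ?_).symm
  rintro _ ⟨P, q, hq, rfl⟩
  exact Pauli.op_commute _ _ fun e => Set.disjoint_left.1 h hq (e ▸ hq')

end Pauli

/-- `outcomeProj T b` as a linear map, for linear `T`. -/
noncomputable def projOp (T : Module.End ℂ (State Q)) (b : Bool) : Module.End ℂ (State Q) :=
  (1 / 2 : ℂ) • (1 + (if b then -1 else 1 : ℂ) • T)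

theorem projOp_apply (T : Module.End ℂ (State Q)) (b : Bool) (ψ : State Q) :
    projOp T b ψ = outcomeProj T b ψ := by
  ext x
  simp only [projOp, outcomeProj, LinearMap.smul_apply, LinearMap.add_apply, Module.End.one_apply,
    Pi.smul_apply, Pi.add_apply, smul_eq_mul]
  ring

variable [DecidableEq Q]

theorem projOp_mem_localOps {S : Set Q} {T : Module.End ℂ (State Q)} (h : T ∈ localOps S)
    (b : Bool) : projOp T b ∈ localOps S :=
  Subalgebra.smul_mem _ (Subalgebra.add_mem _ (Subalgebra.one_mem _)
    (Subalgebra.smul_mem _ h _)) _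

/-- `phaseAct γ q` as a combination of the identity and `Z`. -/
noncomputable def phaseOp (γ : ℝ) (q : Q) : Module.End ℂ (State Q) :=
  ((1 + Complex.exp (Complex.I * γ)) / 2) • 1 +
    ((1 - Complex.exp (Complex.I * γ)) / 2) • Pauli.Z.op q

theorem phaseOp_apply (γ : ℝ) (q : Q) (ψ : State Q) : phaseOp γ q ψ = phaseAct γ q ψ := by
  ext x
  simp only [phaseOp, phaseAct, LinearMap.smul_apply, LinearMap.add_apply, Module.End.one_apply,
    Pi.smul_apply, Pi.add_apply, smul_eq_mul, Pauli.op_apply, Pauli.act]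
  cases x q <;> simp <;> ring

theorem phaseOp_mem_localOps (γ : ℝ) {q : Q} {S : Set Q} (h : q ∈ S) :
    phaseOp γ q ∈ localOps S :=
  Subalgebra.add_mem _ (Subalgebra.smul_mem _ (Subalgebra.one_mem _) _)
    (Subalgebra.smul_mem _ (Pauli.op_mem_localOps _ h) _)

/-- The operator that a two-qubit measurement applies. -/
noncomputable def PairMeas.effect (ω m : B → Bool) (p : PairMeas Q B) : Module.End ℂ (State Q) :=
  match p.basis (m p.ctrl) with
  | none => 1
  | some (P₁, P₂) => projOp (P₁.op p.fst * P₂.op p.snd) (ω p.out)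

theorem PairMeas.effect_apply (ω m : B → Bool) (p : PairMeas Q B) (ψ : State Q) :
    p.effect ω m ψ = p.project ω m ψ := by
  unfold PairMeas.effect PairMeas.project
  cases p.basis (m p.ctrl) with
  | none => rfl
  | some P => simp only [projOp_apply]; rfl

theorem PairMeas.effect_mem_localOps (ω m : B → Bool) (p : PairMeas Q B) {S : Set Q}
    (h₁ : p.fst ∈ S) (h₂ : p.snd ∈ S) : p.effect ω m ∈ localOps S := by
  unfold PairMeas.effect
  split
  · exact Subalgebra.one_mem _
  · exact projOp_mem_localOps (Subalgebra.mul_mem _ (Pauli.op_mem_localOps _ h₁)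
      (Pauli.op_mem_localOps _ h₂)) _

/-- The operator that an instruction applies, if the classical bits have the values `m`. -/
noncomputable def Op.effect (γ : ℝ) (ω m : B → Bool) : Op Q B → Module.End ℂ (State Q)
  | .gate P q ctrl => if m ctrl then P.op q else 1
  | .meas q basis ctrl out =>
    match basis (m ctrl) with
    | none => 1
    | some P => projOp (P.op q) (ω out)
  | .logic _ _ _ _ => 1
  | .merge ms => (ms.map (PairMeas.effect ω m)).reverse.prod
  | .phase q => phaseOp γ q

theorem prod_reverse_effect_apply (ω m : B → Bool) (ms : List (PairMeas Q B)) (ψ : State Q) :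
    (ms.map (PairMeas.effect ω m)).reverse.prod ψ =
      ms.foldl (fun φ p => p.project ω m φ) ψ := by
  induction ms generalizing ψ with
  | nil => rfl
  | cons p ms ih =>
    simp only [List.map_cons, List.reverse_cons, List.prod_append, List.prod_singleton,
      Module.End.mul_apply, ih, List.foldl_cons, PairMeas.effect_apply]

theorem Op.effect_mem_localOps (γ : ℝ) (ω m : B → Bool) (o : Op Q B) :
    o.effect γ ω m ∈ localOps {q | q ∈ o.qubits} := by
  cases o with
  | gate P q ctrl =>
    simp only [Op.effect]
    split
    · exact Pauli.op_mem_localOps _ (by simp [Op.qubits])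
    · exact Subalgebra.one_mem _
  | meas q basis ctrl out =>
    simp only [Op.effect]
    split
    · exact Subalgebra.one_mem _
    · exact projOp_mem_localOps (Pauli.op_mem_localOps _ (by simp [Op.qubits])) _
  | logic f a b out => exact Subalgebra.one_mem _
  | merge ms =>
    refine Subalgebra.list_prod_mem _ fun T hT => ?_
    obtain ⟨p, hp, rfl⟩ := List.mem_map.1 (List.mem_reverse.1 hT)
    exact p.effect_mem_localOps ω m (List.mem_flatMap.2 ⟨p, hp, by simp⟩)
      (List.mem_flatMap.2 ⟨p, hp, by simp⟩)
  | phase q => exact phaseOp_mem_localOps _ (by simp [Op.qubits])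

end Operators

/-! ### Classical bits -/

section Memory

variable {Q B : Type}

/-- The classical bits that an instruction reads. -/
def Op.reads : Op Q B → List B
  | .gate _ _ ctrl => [ctrl]
  | .meas _ _ ctrl _ => [ctrl]
  | .logic _ a b _ => [a, b]
  | .merge ms => ms.map PairMeas.ctrl
  | .phase _ => []

theorem Op.effect_congr [DecidableEq Q] (γ : ℝ) (ω : B → Bool) {m m' : B → Bool} (o : Op Q B)
    (h : ∀ b ∈ o.reads, m b = m' b) : o.effect γ ω m = o.effect γ ω m' := by
  cases o with
  | gate P q ctrl => simp only [Op.effect, h ctrl (by simp [Op.reads])]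
  | meas q basis ctrl out => simp only [Op.effect, h ctrl (by simp [Op.reads])]
  | logic f a b out => rfl
  | merge ms =>
    simp only [Op.effect]
    congr 2
    refine List.map_congr_left fun p hp => ?_
    simp only [PairMeas.effect, h p.ctrl (List.mem_map_of_mem hp)]
  | phase q => rfl

variable [DecidableEq B]

/-- The values of the classical bits after an instruction, if they were `m` before. -/
def Op.memory (ω m : B → Bool) : Op Q B → B → Bool
  | .gate _ _ _ => m
  | .meas _ basis ctrl out =>
    match basis (m ctrl) with
    | none => m
    | some _ => Function.update m out (ω out)
  | .logic f a b out => Function.update m out (f (m a) (m b))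
  | .merge ms => ms.foldl (fun m' p => p.record ω m m') m
  | .phase _ => m

theorem foldl_record_apply (ω m m' : B → Bool) (ms : List (PairMeas Q B)) (b : B) :
    ms.foldl (fun m' p => p.record ω m m') m' b =
      if ∃ p ∈ ms, b = p.out ∧ (p.basis (m p.ctrl)).isSome then ω b else m' b := by
  induction ms generalizing m' with
  | nil => simp
  | cons p ms ih =>
    have hp : p.record ω m m' b =
        if b = p.out ∧ (p.basis (m p.ctrl)).isSome then ω b else m' b := by
      rw [PairMeas.record]
      cases p.basis (m p.ctrl) with
      | none => simp
      | some P =>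
        by_cases hb : b = p.out
        · simp [hb]
        · simp [hb]
    rw [List.foldl_cons, ih, hp]
    simp only [List.exists_mem_cons_iff, or_comm (b := ∃ _, _), ite_or]

theorem Op.memory_of_notMem_writes (ω m : B → Bool) (o : Op Q B) {b : B} (h : b ∉ o.writes) :
    o.memory ω m b = m b := by
  cases o with
  | gate P q ctrl => rfl
  | meas q basis ctrl out =>
    simp only [Op.memory]
    cases basis (m ctrl) with
    | none => rfl
    | some P => exact Function.update_of_ne (by simpa [Op.writes] using h) _ _
  | logic f a c out => exact Function.update_of_ne (by simpa [Op.writes] using h) _ _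
  | merge ms =>
    refine (foldl_record_apply ω m m ms b).trans (if_neg ?_)
    rintro ⟨p, hp, rfl, -⟩
    exact h (List.mem_map_of_mem hp)
  | phase q => rfl

theorem Op.memory_congr (ω : B → Bool) {m m' : B → Bool} (o : Op Q B)
    (h : ∀ b ∈ o.reads, m b = m' b) {b : B} (hb : m b = m' b) :
    o.memory ω m b = o.memory ω m' b := by
  cases o with
  | gate P q ctrl => exact hb
  | meas q basis ctrl out =>
    simp only [Op.memory, ← h ctrl (by simp [Op.reads])]
    cases basis (m ctrl) with
    | none => exact hb
    | some P => simp only [Function.update_apply, hb]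
  | logic f a c out =>
    simp only [Op.memory, ← h a (by simp [Op.reads]), ← h c (by simp [Op.reads]),
      Function.update_apply, hb]
  | merge ms =>
    simp only [Op.memory, foldl_record_apply, hb]
    refine if_congr (exists_congr fun p => and_congr_right fun hp => ?_) rfl rfl
    rw [h p.ctrl (List.mem_map_of_mem hp)]
  | phase q => exact hb

theorem Op.run_eq [DecidableEq Q] (γ : ℝ) (ω : B → Bool) (o : Op Q B) (ψ : State Q)
    (m : B → Bool) : o.run γ ω (ψ, m) = (o.effect γ ω m ψ, o.memory ω m) := by
  cases o with
  | gate P q ctrl =>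
    simp only [Op.run, Op.effect, Op.memory]
    split <;> rfl
  | meas q basis ctrl out =>
    simp only [Op.run, Op.effect, Op.memory]
    cases basis (m ctrl) with
    | none => rfl
    | some P => simp only [projOp_apply]; rfl
  | logic f a b out => rfl
  | merge ms => simp only [Op.run, Op.effect, Op.memory, prod_reverse_effect_apply]
  | phase q => simp only [Op.run, Op.effect, Op.memory, phaseOp_apply]

end Memory

/-! ### Programs -/

section Programs

variable {Q B : Type}

/-- None of the bits that the program `l` writes is set in `m`. Instructions controlled by the
outcome of a measurement that has been skipped are then skipped as well. -/
def Fresh (m : B → Bool) (l : List (Op Q B)) : Prop :=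
  ∀ b ∈ l.flatMap Op.writes, m b = false

theorem Fresh.of_append_left {m : B → Bool} {l l' : List (Op Q B)} (h : Fresh m (l ++ l')) :
    Fresh m l := fun b hb => h b (by
  rw [List.flatMap_append]
  exact List.mem_append_left _ hb)

theorem nodup_writes_of_append {l l' : List (Op Q B)}
    (h : ((l ++ l').flatMap Op.writes).Nodup) :
    (l.flatMap Op.writes).Nodup ∧ (l'.flatMap Op.writes).Nodup := by
  rw [List.flatMap_append] at h
  exact ⟨h.of_append_left, h.of_append_right⟩

variable [DecidableEq B]

/-- The values of the classical bits after the program `l`, if they were `m` before. -/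
def execMemory (ω : B → Bool) (l : List (Op Q B)) (m : B → Bool) : B → Bool :=
  l.foldl (fun m o => o.memory ω m) m

theorem execMemory_cons (ω : B → Bool) (o : Op Q B) (l : List (Op Q B)) (m : B → Bool) :
    execMemory ω (o :: l) m = execMemory ω l (o.memory ω m) := rfl

theorem execMemory_append (ω : B → Bool) (l l' : List (Op Q B)) (m : B → Bool) :
    execMemory ω (l ++ l') m = execMemory ω l' (execMemory ω l m) :=
  List.foldl_append ..

theorem execMemory_of_notMem_writes (ω : B → Bool) (l : List (Op Q B)) (m : B → Bool) {b : B}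
    (h : b ∉ l.flatMap Op.writes) : execMemory ω l m b = m b := by
  induction l generalizing m with
  | nil => rfl
  | cons o l ih =>
    rw [List.flatMap_cons, List.mem_append, not_or] at h
    rw [execMemory_cons, ih _ h.2, o.memory_of_notMem_writes ω m h.1]

theorem Fresh.execMemory {m : B → Bool} {l l' : List (Op Q B)} (h : Fresh m (l ++ l'))
    (hw : ((l ++ l').flatMap Op.writes).Nodup) (ω : B → Bool) :
    Fresh (execMemory ω l m) l' := fun b hb => by
  rw [List.flatMap_append] at hw
  rw [execMemory_of_notMem_writes ω l m fun hb' => hw.disjoint hb' hb]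
  refine h b ?_
  rw [List.flatMap_append]
  exact List.mem_append_right _ hb

variable [DecidableEq Q]

/-- The operator that the program `l` applies, if the classical bits are `m` at its start. -/
noncomputable def execState (γ : ℝ) (ω : B → Bool) :
    List (Op Q B) → (B → Bool) → Module.End ℂ (State Q)
  | [], _ => 1
  | o :: l, m => execState γ ω l (o.memory ω m) * o.effect γ ω m

theorem execState_singleton (γ : ℝ) (ω : B → Bool) (o : Op Q B) (m : B → Bool) :
    execState γ ω [o] m = o.effect γ ω m := one_mul _

theorem execState_append (γ : ℝ) (ω : B → Bool) (l l' : List (Op Q B)) (m : B → Bool) :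
    execState γ ω (l ++ l') m = execState γ ω l' (execMemory ω l m) * execState γ ω l m := by
  induction l generalizing m with
  | nil => rfl
  | cons o l ih =>
    rw [List.cons_append, execState, ih, mul_assoc]
    rfl

theorem foldl_run_eq (γ : ℝ) (ω : B → Bool) (l : List (Op Q B)) (ψ : State Q) (m : B → Bool) :
    l.foldl (fun c o => o.run γ ω c) (ψ, m) = (execState γ ω l m ψ, execMemory ω l m) := by
  induction l generalizing ψ m with
  | nil => rfl
  | cons o l ih =>
    rw [List.foldl_cons, Op.run_eq, ih]
    rfl

end Programs

/-! ### Rescheduling -/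

section Reordering

variable {Q B : Type}

/-- Two instructions are independent if they act on different qubits and neither writes a classical
bit that the other one reads or writes. -/
structure Op.Indep (o o' : Op Q B) : Prop where
  qubits : o.qubits.Disjoint o'.qubits
  reads_writes : o.reads.Disjoint o'.writes
  writes_reads : o.writes.Disjoint o'.reads
  writes_writes : o.writes.Disjoint o'.writes

variable [DecidableEq B]

theorem Op.Indep.memory_comm {o o' : Op Q B} (h : o.Indep o') (ω m : B → Bool) :
    o'.memory ω (o.memory ω m) = o.memory ω (o'.memory ω m) := by
  funext b
  by_cases hb : b ∈ o.writes
  · rw [o'.memory_of_notMem_writes ω _ (h.writes_writes hb)]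
    exact (o.memory_congr ω (fun b' hb' => o'.memory_of_notMem_writes ω m (h.reads_writes hb'))
      (o'.memory_of_notMem_writes ω m (h.writes_writes hb))).symm
  · rw [o.memory_of_notMem_writes ω _ hb]
    exact o'.memory_congr ω
      (fun b' hb' => o.memory_of_notMem_writes ω m fun hw => h.writes_reads hw hb')
      (o.memory_of_notMem_writes ω m hb)

variable [DecidableEq Q]

theorem Op.Indep.effect_comm {o o' : Op Q B} (h : o.Indep o') (γ : ℝ) (ω m : B → Bool) :
    o'.effect γ ω (o.memory ω m) * o.effect γ ω m =
      o.effect γ ω (o'.memory ω m) * o'.effect γ ω m := by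
  rw [o'.effect_congr γ ω fun b hb => o.memory_of_notMem_writes ω m fun hw => h.writes_reads hw hb,
    o.effect_congr γ ω fun b hb => o'.memory_of_notMem_writes ω m (h.reads_writes hb)]
  exact (commute_of_mem_localOps (Set.disjoint_left.2 fun q hq hq' => h.qubits hq hq')
    (o.effect_mem_localOps γ ω m) (o'.effect_mem_localOps γ ω m)).symm.eq

/-- The program `l'` is another schedule of the program `l`: both have the same effect, write the
same bits and consist of the same number of elementary operations. -/
structure Reorders (l l' : List (Op Q B)) : Prop where
  execState : ∀ γ ω m, execState γ ω l m = execState γ ω l' m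
  execMemory : ∀ ω m, execMemory ω l m = execMemory ω l' m
  writes : (l.flatMap Op.writes).Perm (l'.flatMap Op.writes)
  size : (l.map Op.size).sum = (l'.map Op.size).sum

namespace Reorders

theorem refl (l : List (Op Q B)) : Reorders l l :=
  ⟨fun _ _ _ => rfl, fun _ _ => rfl, .refl _, rfl⟩

theorem trans {l l' l'' : List (Op Q B)} (h : Reorders l l') (h' : Reorders l' l'') :
    Reorders l l'' :=
  ⟨fun γ ω m => (h.execState γ ω m).trans (h'.execState γ ω m),
    fun ω m => (h.execMemory ω m).trans (h'.execMemory ω m),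
    h.writes.trans h'.writes, h.size.trans h'.size⟩

theorem append {l₁ l₁' l₂ l₂' : List (Op Q B)} (h₁ : Reorders l₁ l₁') (h₂ : Reorders l₂ l₂') :
    Reorders (l₁ ++ l₂) (l₁' ++ l₂') :=
  ⟨fun γ ω m => by simp only [execState_append, h₁.execState, h₁.execMemory, h₂.execState],
    fun ω m => by simp only [execMemory_append, h₁.execMemory, h₂.execMemory],
    by simpa only [List.flatMap_append] using h₁.writes.append h₂.writes,
    by simp only [List.map_append, List.sum_append, h₁.size, h₂.size]⟩

theorem flatMap {ι : Type*} {f g : ι → List (Op Q B)} (N : List ι)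
    (h : ∀ j ∈ N, Reorders (f j) (g j)) : Reorders (N.flatMap f) (N.flatMap g) := by
  induction N with
  | nil => exact refl _
  | cons j N ih =>
    simp only [List.flatMap_cons]
    exact (h j (by simp)).append (ih fun i hi => h i (by simp [hi]))

theorem pair_comm {o o' : Op Q B} (h : o.Indep o') : Reorders [o, o'] [o', o] where
  execState γ ω m := by
    simpa only [LatticeSurgery.execState, one_mul] using h.effect_comm γ ω m
  execMemory ω m := h.memory_comm ω m
  writes := by simpa only [List.flatMap_cons, List.flatMap_nil, List.append_nil] using
    List.perm_append_comm
  size := by simp only [List.map_cons, List.map_nil, List.sum_cons, List.sum_nil]; omega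

theorem cons_comm {o : Op Q B} {l : List (Op Q B)} (h : ∀ o' ∈ l, o.Indep o') :
    Reorders (o :: l) (l ++ [o]) := by
  induction l with
  | nil => exact refl _
  | cons o' l ih =>
    exact ((pair_comm (h o' (by simp))).append (refl l)).trans
      ((refl [o']).append (ih fun o'' ho => h o'' (by simp [ho])))

theorem append_comm {l l' : List (Op Q B)} (h : ∀ o ∈ l, ∀ o' ∈ l', o.Indep o') :
    Reorders (l ++ l') (l' ++ l) := by
  induction l with
  | nil => simpa using refl l'
  | cons o l ih =>
    have h₁ := (refl [o]).append (ih fun o' ho => h o' (by simp [ho]))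
    have h₂ := (cons_comm (h o (by simp))).append (refl l)
    simp only [List.append_assoc, List.cons_append] at h₁ h₂ ⊢
    exact h₁.trans h₂

theorem flatMap_append {ι : Type*} {f g : ι → List (Op Q B)} {N : List ι}
    (h : N.Pairwise fun i j => ∀ o ∈ f j, ∀ o' ∈ g i, o.Indep o') :
    Reorders (N.flatMap f ++ N.flatMap g) (N.flatMap fun j => f j ++ g j) := by
  induction N with
  | nil => exact refl _
  | cons j N ih =>
    obtain ⟨hj, hN⟩ := List.pairwise_cons.1 h
    simp only [List.flatMap_cons]
    have h₁ : Reorders (N.flatMap f ++ g j) (g j ++ N.flatMap f) := by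
      refine append_comm fun o ho => ?_
      obtain ⟨i, hi, ho⟩ := List.mem_flatMap.1 ho
      exact hj i hi o ho
    have h₂ := (refl (f j)).append (h₁.append (refl (N.flatMap g)))
    have h₃ := (refl (f j ++ g j)).append (ih hN)
    simp only [List.append_assoc] at h₂ h₃ ⊢
    exact h₂.trans h₃

theorem merge_append {ms ms' : List (PairMeas Q B)} (h : ∀ p ∈ ms, ∀ p' ∈ ms', p.out ≠ p'.ctrl) :
    Reorders [Op.merge (ms ++ ms')] [Op.merge ms, Op.merge ms'] := by
  have hm (ω m : B → Bool) : ∀ p' ∈ ms', (Op.merge ms).memory ω m p'.ctrl = m p'.ctrl := by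
    refine fun p' hp' => (Op.merge ms).memory_of_notMem_writes ω m ?_
    simp only [Op.writes, List.mem_map, not_exists, not_and]
    exact fun p hp => h p hp p' hp'
  refine ⟨fun γ ω m => ?_, fun ω m => ?_, by simp [Op.writes], by simp [Op.size]⟩
  · have heffect : ms'.map (PairMeas.effect ω m) =
        ms'.map (PairMeas.effect ω ((Op.merge ms).memory ω m)) :=
      List.map_congr_left fun p' hp' => by simp only [PairMeas.effect, hm ω m p' hp']
    simp only [LatticeSurgery.execState, Op.effect, one_mul, List.map_append, List.reverse_append,
      List.prod_append, heffect]
  · refine (List.foldl_append ..).trans (List.foldl_ext _ _ _ fun n p' hp' => ?_)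
    simp only [PairMeas.record, hm ω m p' hp']

end Reorders

end Reordering

/-! ### Measurement gadgets -/

section Rounds

variable {Q B : Type}

/-- One logical cycle of a circuit: a layer of simultaneous two-qubit measurements, followed by
instructions that take no time. -/
structure Round (Q B : Type) where
  pairs : List (PairMeas Q B)
  rest : List (Op Q B)

/-- The instructions of a round. -/
def Round.ops (r : Round Q B) : List (Op Q B) := .merge r.pairs :: r.rest

/-- The simultaneous execution of several rounds. -/
def Round.par (N : List (Round Q B)) : Round Q B := ⟨N.flatMap Round.pairs, N.flatMap Round.rest⟩

/-- The classical bits used in the erasure of a qubit: the outcomes of the two-qubit measurement, of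
the single-qubit measurement that may replace it, and of the measurement that discards the qubit
after a two-qubit measurement; and the outcome of whichever of the first two is performed. -/
structure EraseBits (B : Type) where
  joint : B
  single : B
  discard : B
  outcome : B

/-- Measure `X` on `q` if `ctrl` is `false`, and `X` on `q` times `Z` on `o` if `ctrl` is `true`;
then discard `q`. -/
def erase (q o : Q) (ctrl : B) (r : EraseBits B) : Round Q B where
  pairs := [⟨q, o, fun c => if c then some (.X, .Z) else none, ctrl, r.joint⟩]
  rest := [.meas q (fun c => if c then none else some .X) ctrl r.single,
    .meas q (fun c => if c then some .Z else none) ctrl r.discard,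
    .gate .Z o r.discard,
    .logic xor r.joint r.single r.outcome]

/-- First half of the coupling of `e`, which is in the state `|0⟩`, to `t` by a controlled `Z`
gate. -/
def attachTarget (e t : Q) (idle out : B) : Round Q B where
  pairs := [⟨e, t, fun _ => some (.X, .Z), idle, out⟩]
  rest := [.gate .Z e out]

/-- Second half of the coupling of `e` to `t`, which makes `e` a copy of `c`. -/
def attachSource (c e t : Q) (idle out : B) : Round Q B where
  pairs := [⟨c, e, fun _ => some (.Z, .Z), idle, out⟩]
  rest := [.gate .X e out, .gate .Z t out]

theorem execMemory_erase_outcome [DecidableEq B] (ω : B → Bool) {m : B → Bool} (q o : Q) {ctrl : B}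
    {r : EraseBits B} (hr : [ctrl, r.joint, r.single, r.discard, r.outcome].Nodup)
    (hm : Fresh m (erase q o ctrl r).ops) :
    execMemory ω (erase q o ctrl r).ops m r.outcome =
      if m ctrl then ω r.joint else ω r.single := by
  simp only [Fresh, erase, Round.ops, Op.writes, List.flatMap_cons, List.map_cons, List.map_nil,
    List.flatMap_nil, List.nil_append, List.cons_append, List.append_nil, List.mem_cons,
    List.not_mem_nil, or_false, forall_eq_or_imp, forall_eq] at hm
  simp only [List.nodup_cons, List.mem_cons, List.not_mem_nil, or_false, not_or] at hr
  obtain ⟨⟨h₁, h₂, -, -⟩, ⟨h₄, h₅, -⟩, ⟨h₆, -⟩, -⟩ := hr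
  simp only [erase, Round.ops, execMemory, List.foldl_cons, List.foldl_nil, Op.memory,
    PairMeas.record]
  cases hc : m ctrl <;>
    simp [hc, hm, h₁, h₂, h₄, h₅, h₆, Ne.symm h₄, Function.update_of_ne]

end Rounds

section Gadgets

/-- The sign `(-1)^b`. -/
def sgn (b : Bool) : ℂ := if b then -1 else 1

@[simp] theorem sgn_false : sgn false = 1 := rfl

@[simp] theorem sgn_true : sgn true = -1 := rfl

/-- The amplitude `⟨a|b⟩` of two computational basis states of a qubit. -/
def overlap (a b : Bool) : ℂ := if a = b then 1 else 0

@[simp] theorem overlap_self (a : Bool) : overlap a a = 1 := if_pos rfl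

@[simp] theorem overlap_true_false : overlap true false = 0 := rfl

@[simp] theorem overlap_false_true : overlap false true = 0 := rfl

theorem sgn_xor (a b : Bool) : sgn (xor a b) = sgn a * sgn b := by
  cases a <;> cases b <;> simp

theorem overlap_xor (a b c : Bool) : overlap (xor a c) (xor b c) = overlap a b := by
  cases a <;> cases b <;> cases c <;> rfl

theorem overlap_eq_div_two (a b : Bool) : overlap a b = (1 + sgn (xor a b)) / 2 := by
  cases a <;> cases b <;> simp

variable {Q : Type} [DecidableEq Q]

theorem projOp_X_apply (q : Q) (b : Bool) (Φ : State Q) (z : Q → Bool) :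
    projOp (Pauli.X.op q) b Φ z =
      sgn (z q && b) / 2 * ∑ v, sgn (v && b) * Φ (Function.update z q v) := by
  rw [projOp_apply]
  cases hz : z q <;> cases b <;>
    simp [outcomeProj, Pauli.op_apply, Pauli.act, hz] <;>
    simp [← hz, Function.update_eq_self] <;> ring

theorem projOp_X_mul_Z_apply {q o : Q} (hqo : o ≠ q) (b : Bool) (Φ : State Q) (z : Q → Bool) :
    projOp (Pauli.X.op q * Pauli.Z.op o) b Φ z =
      sgn (z q && xor b (z o)) / 2 *
        ∑ v, sgn (v && xor b (z o)) * Φ (Function.update z q v) := by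
  rw [projOp_apply]
  cases hz : z q <;> cases ho : z o <;> cases b <;>
    simp [outcomeProj, Pauli.op_apply, Pauli.act, hz, ho, Function.update_of_ne hqo] <;>
    simp [← hz, Function.update_eq_self] <;> ring

theorem projOp_Z_apply (q : Q) (b : Bool) (Φ : State Q) (z : Q → Bool) :
    projOp (Pauli.Z.op q) b Φ z = overlap (z q) b * Φ z := by
  rw [projOp_apply]
  cases hz : z q <;> cases b <;> simp [outcomeProj, Pauli.op_apply, Pauli.act, hz]

theorem projOp_Z_mul_Z_apply (q o : Q) (b : Bool) (Φ : State Q) (z : Q → Bool) :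
    projOp (Pauli.Z.op q * Pauli.Z.op o) b Φ z = overlap (xor (z q) (z o)) b * Φ z := by
  rw [projOp_apply]
  cases hz : z q <;> cases ho : z o <;> cases b <;>
    simp [outcomeProj, Pauli.op_apply, Pauli.act, hz, ho]

theorem ite_X_apply (b : Bool) (q : Q) (Φ : State Q) (z : Q → Bool) :
    (if b then Pauli.X.op q else 1 : Module.End ℂ (State Q)) Φ z =
      Φ (Function.update z q (xor (z q) b)) := by
  cases b <;> simp [Pauli.op_apply, Pauli.act]

theorem ite_Z_apply (b : Bool) (q : Q) (Φ : State Q) (z : Q → Bool) :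
    (if b then Pauli.Z.op q else 1 : Module.End ℂ (State Q)) Φ z = sgn (b && z q) * Φ z := by
  cases b <;> simp [Pauli.op_apply, Pauli.act, sgn]

variable {B : Type} [DecidableEq B]

/-- Whichever measurement is performed, its outcome `w` together with the control makes the erasure
project `q` onto `⟨0| + (-1)^{w + ctrl·o} ⟨1|`. -/
theorem exists_execState_erase (γ : ℝ) (ω : B → Bool) {m : B → Bool} {q o : Q} {ctrl : B}
    {r : EraseBits B} (hqo : o ≠ q)
    (hr : [ctrl, r.joint, r.single, r.discard, r.outcome].Nodup)
    (hm : Fresh m (erase q o ctrl r).ops) :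
    ∃ χ : Bool → ℂ, ∀ Φ : State Q, execState γ ω (erase q o ctrl r).ops m Φ = fun z =>
      χ (z q) * ∑ v, sgn (v && xor (execMemory ω (erase q o ctrl r).ops m r.outcome)
        (m ctrl && z o)) * Φ (Function.update z q v) := by
  rw [execMemory_erase_outcome ω q o hr hm]
  simp only [Fresh, erase, Round.ops, Op.writes, List.flatMap_cons, List.map_cons, List.map_nil,
    List.flatMap_nil, List.nil_append, List.cons_append, List.append_nil, List.mem_cons,
    List.not_mem_nil, or_false, forall_eq_or_imp, forall_eq] at hm
  simp only [List.nodup_cons, List.mem_cons, List.not_mem_nil, or_false, not_or] at hr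
  obtain ⟨⟨h₁, h₂, -, -⟩, -, ⟨h₆, -⟩, -⟩ := hr
  cases hc : m ctrl with
  | false =>
    refine ⟨fun u => sgn (u && ω r.single) / 2, fun Φ => funext fun z => ?_⟩
    simp [erase, Round.ops, execState, Op.effect, Op.memory, PairMeas.effect, PairMeas.record,
      hc, hm, h₂, Ne.symm h₆, projOp_X_apply]
  | true =>
    refine ⟨fun u => overlap u (ω r.discard) * (sgn (u && ω r.joint) / 2),
      fun Φ => funext fun z => ?_⟩
    simp only [erase, Round.ops, execState, Op.effect, Op.memory, PairMeas.effect,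
      PairMeas.record, hc, List.map_cons, List.map_nil, List.reverse_singleton,
      List.prod_singleton, List.foldl_cons, List.foldl_nil, Function.update_of_ne h₁,
      if_true, Function.update_self, one_mul, Module.End.mul_apply, Module.End.one_apply,
      ite_Z_apply, projOp_Z_apply, projOp_X_mul_Z_apply hqo, Bool.true_and]
    generalize ∑ v, sgn (v && xor (ω r.joint) (z o)) * Φ (Function.update z q v) = s
    cases z q <;> cases z o <;> cases ω r.discard <;> cases ω r.joint <;> simp <;> ring

theorem execState_attach (γ : ℝ) (ω m : B → Bool) {c e t : Q} (idle α β : B) (hce : c ≠ e)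
    (hte : t ≠ e) {Φ : State Q} (hΦ : ∀ z v, Φ (Function.update z e v) = Φ z) :
    execState γ ω ((attachTarget e t idle α).ops ++ (attachSource c e t idle β).ops) m
        (fun z => overlap (z e) false * Φ z) =
      fun z => overlap (z c) (z e) * sgn (z e && z t) / 2 * Φ z := by
  funext z
  simp only [attachTarget, attachSource, Round.ops, List.cons_append, List.nil_append, execState,
    Op.effect, Op.memory, PairMeas.effect, PairMeas.record, List.map_cons, List.map_nil,
    List.reverse_singleton, List.prod_singleton, List.foldl_cons, List.foldl_nil, one_mul,
    Module.End.mul_apply, Function.update_self, ite_Z_apply, ite_X_apply, projOp_Z_mul_Z_apply,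
    projOp_X_mul_Z_apply hte, Function.update_of_ne hce, Function.update_of_ne hte, hΦ,
    Fintype.sum_bool, Function.update_idem]
  cases z c <;> cases z e <;> cases z t <;> cases ω α <;> cases ω β <;> simp <;> ring

end Gadgets

/-! ### Parallel rounds -/

section Parallel

variable {Q B : Type}

theorem Op.Indep.symm {o o' : Op Q B} (h : o.Indep o') : o'.Indep o :=
  ⟨h.qubits.symm, h.writes_reads.symm, h.reads_writes.symm, h.writes_writes.symm⟩

/-- The two-qubit measurements of `r'` may be performed together with those of `r`, before the
other instructions of `r`. -/
structure Round.Precedes (r r' : Round Q B) : Prop where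
  out_ne_ctrl : ∀ p ∈ r.pairs, ∀ p' ∈ r'.pairs, p.out ≠ p'.ctrl
  indep : ∀ o ∈ r.rest, Op.Indep (.merge r'.pairs) o

theorem Round.Precedes.of_indep {r r' : Round Q B}
    (h : ∀ o ∈ r.ops, ∀ o' ∈ r'.ops, o.Indep o') : r.Precedes r' where
  out_ne_ctrl _ hp _ hp' e :=
    (h _ List.mem_cons_self _ List.mem_cons_self).writes_reads
      (List.mem_map_of_mem hp) (e ▸ List.mem_map_of_mem hp')
  indep o ho := (h o (List.mem_cons_of_mem _ ho) _ List.mem_cons_self).symm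

theorem Round.Precedes.of_pairs_eq_nil {r r' : Round Q B} (h : r'.pairs = []) : r.Precedes r' where
  out_ne_ctrl _ _ _ hp' := by simp [h] at hp'
  indep _ _ := by constructor <;> simp [h, Op.qubits, Op.reads, Op.writes]

/-- The instruction takes no time. -/
def Op.Instant (o : Op Q B) : Prop := ∀ nP, o.cycles nP = 0

theorem sum_cycles_flatMap_ops {rs : List (Round Q B)} (h : ∀ r ∈ rs, ∀ o ∈ r.rest, o.Instant)
    (nP : ℕ) : ((rs.flatMap Round.ops).map (Op.cycles nP)).sum = rs.length := by
  induction rs with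
  | nil => rfl
  | cons r rs ih =>
    have hr : (r.rest.map (Op.cycles nP)).sum = 0 :=
      List.sum_eq_zero fun n hn => by
        obtain ⟨o, ho, rfl⟩ := List.mem_map.1 hn
        exact h r (by simp) o ho nP
    simp only [List.flatMap_cons, List.map_append, List.sum_append, Round.ops, List.map_cons,
      List.sum_cons, hr, ih fun r' hr' => h r' (by simp [hr']), List.length_cons, Op.cycles]
    omega

theorem exists_pairs_eq_of_merge_mem {rs : List (Round Q B)}
    (h : ∀ r ∈ rs, ∀ o ∈ r.rest, o.Instant) {ms : List (PairMeas Q B)}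
    (hms : .merge ms ∈ rs.flatMap Round.ops) : ∃ r ∈ rs, ms = r.pairs := by
  obtain ⟨r, hr, hms⟩ := List.mem_flatMap.1 hms
  rcases List.mem_cons.1 hms with e | hms
  · exact ⟨r, hr, Op.merge.inj e⟩
  · exact absurd (h r hr _ hms 0) one_ne_zero

variable [DecidableEq Q] [DecidableEq B]

theorem Reorders.merge_nil : Reorders [Op.merge ([] : List (PairMeas Q B))] [] :=
  ⟨fun _ _ _ => rfl, fun _ _ => rfl, .refl _, rfl⟩

theorem Reorders.merge_flatMap {ι : Type*} {f : ι → List (PairMeas Q B)} {N : List ι}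
    (h : N.Pairwise fun i j => ∀ p ∈ f i, ∀ p' ∈ f j, p.out ≠ p'.ctrl) :
    Reorders [.merge (N.flatMap f)] (N.flatMap fun i => [.merge (f i)]) := by
  induction N with
  | nil => exact merge_nil
  | cons i N ih =>
    obtain ⟨hi, hN⟩ := List.pairwise_cons.1 h
    refine (merge_append fun p hp p' hp' => ?_).trans ((refl [_]).append (ih hN))
    obtain ⟨j, hj, hp'⟩ := List.mem_flatMap.1 hp'
    exact hi j hj p hp p' hp'

theorem Round.par_reorders {N : List (Round Q B)} (h : N.Pairwise Round.Precedes) :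
    Reorders (Round.par N).ops (N.flatMap Round.ops) :=
  ((Reorders.merge_flatMap (h.imp Round.Precedes.out_ne_ctrl)).append (.refl _)).trans
    (Reorders.flatMap_append (h.imp fun h o ho o' ho' => by
      rw [List.mem_singleton.1 ho]
      exact h.indep o' ho'))

/-- The simultaneous execution of the programs `fs.map (· j)` for all `j` in `N`. -/
def parallel {ι : Type*} (fs : List (ι → Round Q B)) (N : List ι) : List (Round Q B) :=
  fs.map fun f => Round.par (N.map f)

/-- The sequential execution of the rounds `fs.map (· j)`. -/
def sequential {ι : Type*} (fs : List (ι → Round Q B)) (j : ι) : List (Op Q B) :=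
  fs.flatMap fun f => (f j).ops

theorem parallel_reorders {ι : Type*} (fs : List (ι → Round Q B)) {N : List ι}
    (h : N.Pairwise fun i j => ∀ o ∈ sequential fs i, ∀ o' ∈ sequential fs j, o.Indep o') :
    Reorders ((parallel fs N).flatMap Round.ops) (N.flatMap (sequential fs)) := by
  induction fs with
  | nil =>
    have hnil : N.flatMap (sequential ([] : List (ι → Round Q B))) = [] :=
      List.flatMap_eq_nil_iff.2 fun _ _ => rfl
    rw [hnil]
    exact .refl _
  | cons f fs ih =>
    have hf {o : Op Q B} {j : ι} (ho : o ∈ (f j).ops) : o ∈ sequential (f :: fs) j :=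
      List.mem_append_left _ ho
    have hfs {o : Op Q B} {j : ι} (ho : o ∈ sequential fs j) : o ∈ sequential (f :: fs) j :=
      List.mem_append_right _ ho
    have hround : Reorders (Round.par (N.map f)).ops (N.flatMap fun j => (f j).ops) := by
      rw [← List.flatMap_map]
      exact Round.par_reorders (List.pairwise_map.2 (h.imp fun h =>
        .of_indep fun o ho o' ho' => h o (hf ho) o' (hf ho')))
    refine (hround.append (ih (h.imp fun h o ho o' ho' => h o (hfs ho) o' (hfs ho')))).trans ?_
    exact Reorders.flatMap_append (h.imp fun h o ho o' ho' => (h o' (hfs ho') o (hf ho)).symm)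

end Parallel

/-! ### Programs at the nodes of the tree -/

/-- The roles of the classical bits of the circuit. The bit `frame` of a node says whether a Pauli
`X` correction of its value is pending, the bit `sign` whether a sign `(-1)^value` is present, and
`idle` is never written. -/
inductive BitKind
  | frame
  | attachTarget
  | attachSource
  | upJoint
  | upSingle
  | upDiscard
  | upOutcome
  | andFrames
  | xorOutcomes
  | sign
  | downJoint
  | downSingle
  | downDiscard
  | idle

/-- The classical bit with role `s` that belongs to the node `j`. -/
def bit (s : BitKind) (j : ℕ) : ℕ := Nat.pair s.ctorIdx j

@[simp] theorem bit_inj {s s' : BitKind} {j j' : ℕ} : bit s j = bit s' j' ↔ s = s' ∧ j = j' := by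
  rw [bit, bit, Nat.pair_eq_pair]
  refine and_congr_left' ⟨fun h => ?_, congrArg _⟩
  cases s <;> cases s' <;> first | rfl | exact absurd h (by decide)

section Nodes

variable {Q : Type} (K : ℕ) (w : ℕ → Q) (j : ℕ)

/-- The measurement of the third qubit of the CCZ state of the node `j`, corrected by the frame of
the left child. -/
def eraseProduct : Round Q ℕ :=
  erase (w (2 * K + j)) (w (2 * j + 1)) (bit .frame (2 * j))
    ⟨bit .upJoint (2 * j + 1), bit .upSingle (2 * j + 1), bit .upDiscard (2 * j + 1),
      bit .upOutcome (2 * j + 1)⟩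

/-- The measurement of the copy of the third qubit of the CCZ state of the node `j`, corrected by
the frame of the right child. -/
def eraseCopy : Round Q ℕ :=
  erase (w (3 * K + j)) (w (2 * j)) (bit .frame (2 * j + 1))
    ⟨bit .upJoint (2 * j), bit .upSingle (2 * j), bit .upDiscard (2 * j), bit .upOutcome (2 * j)⟩

/-- The Pauli corrections of the children of the node `j`, and the computation of its frame. -/
def updateFrames : Round Q ℕ where
  pairs := []
  rest := [.gate .X (w (2 * j)) (bit .frame (2 * j)),
    .gate .X (w (2 * j + 1)) (bit .frame (2 * j + 1)),
    .logic and (bit .frame (2 * j)) (bit .frame (2 * j + 1)) (bit .andFrames j),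
    .logic xor (bit .upOutcome (2 * j)) (bit .upOutcome (2 * j + 1)) (bit .xorOutcomes j),
    .logic xor (bit .andFrames j) (bit .xorOutcomes j) (bit .frame j)]

/-- The three rounds that compute the values of nodes of the tree from those of their children. The
value of the node `j` is carried by the qubit `w j`; its CCZ state consists of `w (2 * j)`,
`w (2 * j + 1)` and `w (2 * K + j)`, and `w (3 * K + j)` becomes a copy of the latter. -/
def upRounds : List (ℕ → Round Q ℕ) :=
  [fun j => attachTarget (w (3 * K + j)) (w j) (bit .idle 0) (bit .attachTarget j),
    fun j => attachSource (w (2 * K + j)) (w (3 * K + j)) (w j) (bit .idle 0)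
      (bit .attachSource j),
    fun j => Round.par [eraseProduct K w j, eraseCopy K w j, updateFrames w j]]

/-- The coupling of the ancilla `w (3 * K + j)` to the third qubit of the CCZ state of the node `j`
and to `w j`. -/
def couple : List (Op Q ℕ) :=
  (attachTarget (w (3 * K + j)) (w j) (bit .idle 0) (bit .attachTarget j)).ops ++
    (attachSource (w (2 * K + j)) (w (3 * K + j)) (w j) (bit .idle 0)
      (bit .attachSource j)).ops

/-- The removal of the third qubit of the CCZ state of the node `j` and of its copy. -/
def eraseBoth : List (Op Q ℕ) := (eraseProduct K w j).ops ++ (eraseCopy K w j).ops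

/-- The computation of the value of the node `j`, one measurement after the other. -/
def upNode : List (Op Q ℕ) := couple K w j ++ eraseBoth K w j ++ (updateFrames w j).ops

/-- The measurement of the value of the right child of the node `j`, such that the sign
`(-1)^value` of the node `j` is cancelled. -/
def eraseRight : Round Q ℕ :=
  erase (w (2 * j + 1)) (w (2 * j)) (bit .sign j)
    ⟨bit .downJoint j, bit .downSingle j, bit .downDiscard j, bit .sign (2 * j + 1)⟩

/-- The measurement of the value of the left child of the node `j`. -/
def measureLeft : Round Q ℕ where
  pairs := []
  rest := [.meas (w (2 * j)) (fun _ => some .X) (bit .idle 0) (bit .sign (2 * j))]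

/-- The round that removes the children of nodes of the tree and turns signs `(-1)^value` of these
nodes into signs of the children. -/
def downRounds : List (ℕ → Round Q ℕ) := [fun j => Round.par [eraseRight w j, measureLeft w j]]

/-- The removal of the children of the node `j`. -/
def downNode : List (Op Q ℕ) := (eraseRight w j).ops ++ (measureLeft w j).ops

/-- The bits written by `upNode K w j`. -/
def upBits (j : ℕ) : List ℕ :=
  [bit .attachTarget j, bit .attachSource j, bit .upJoint (2 * j + 1), bit .upSingle (2 * j + 1),
    bit .upDiscard (2 * j + 1), bit .upOutcome (2 * j + 1), bit .upJoint (2 * j),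
    bit .upSingle (2 * j), bit .upDiscard (2 * j), bit .upOutcome (2 * j), bit .andFrames j,
    bit .xorOutcomes j, bit .frame j]

theorem writes_upNode : (upNode K w j).flatMap Op.writes = upBits j := rfl

/-- The bits written by `downNode w j`. -/
def downBits (j : ℕ) : List ℕ :=
  [bit .downJoint j, bit .downSingle j, bit .downDiscard j, bit .sign (2 * j + 1),
    bit .sign (2 * j)]

theorem writes_downNode : (downNode w j).flatMap Op.writes = downBits j := rfl

theorem nodup_upBits : (upBits j).Nodup := by simp [upBits]

theorem nodup_downBits : (downBits j).Nodup := by simp [downBits]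

end Nodes

/-! ### Effect of a node -/

section Effect

variable {Q : Type} {K : ℕ} {w : ℕ → Q} {j : ℕ}

theorem wire_ne (hw : Set.InjOn w (Set.Iio (4 * K))) {i i' : ℕ} (hi : i < 4 * K)
    (hi' : i' < 4 * K) (h : i ≠ i') : w i ≠ w i' := fun e => h (hw hi hi' e)

theorem execMemory_eraseBoth (ω : ℕ → Bool) (m : ℕ → Bool) :
    execMemory ω (eraseBoth K w j) m (bit .upOutcome (2 * j + 1)) =
      execMemory ω (eraseProduct K w j).ops m (bit .upOutcome (2 * j + 1)) := by
  rw [eraseBoth, execMemory_append, execMemory_of_notMem_writes]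
  simp [eraseCopy, erase, Round.ops, Op.writes]

theorem execMemory_eraseProduct_frame (ω : ℕ → Bool) (m : ℕ → Bool) (i : ℕ) :
    execMemory ω (eraseProduct K w j).ops m (bit .frame i) = m (bit .frame i) :=
  execMemory_of_notMem_writes _ _ _ (by simp [eraseProduct, erase, Round.ops, Op.writes])

theorem execMemory_couple_frame (ω m : ℕ → Bool) (i : ℕ) :
    execMemory ω (couple K w j) m (bit .frame i) = m (bit .frame i) :=
  execMemory_of_notMem_writes _ _ _ (by
    simp [couple, attachTarget, attachSource, Round.ops, Op.writes])

theorem execMemory_andGate_frame (ω m : ℕ → Bool) (i : ℕ) :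
    execMemory ω (couple K w j ++ eraseBoth K w j) m (bit .frame i) = m (bit .frame i) := by
  rw [execMemory_append, execMemory_of_notMem_writes, execMemory_couple_frame]
  simp [eraseBoth, eraseProduct, eraseCopy, erase, Round.ops, Op.writes]

theorem execMemory_upNode_frame (ω m : ℕ → Bool) :
    execMemory ω (upNode K w j) m (bit .frame j) =
      xor (m (bit .frame (2 * j)) && m (bit .frame (2 * j + 1)))
        (xor (execMemory ω (couple K w j ++ eraseBoth K w j) m (bit .upOutcome (2 * j)))
          (execMemory ω (couple K w j ++ eraseBoth K w j) m (bit .upOutcome (2 * j + 1)))) := by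
  rw [upNode, execMemory_append, ← execMemory_andGate_frame (K := K) (w := w) (j := j) ω m,
    ← execMemory_andGate_frame (K := K) (w := w) (j := j) ω m]
  simp [execMemory, updateFrames, Round.ops, Op.memory]

variable [DecidableEq Q]

theorem update_of_dependsOn {β : Type*} {f : (Q → Bool) → β} {S : Set Q} (hf : DependsOn f Sᶜ)
    {q : Q} (hq : q ∈ S) (z : Q → Bool) (v : Bool) : f (Function.update z q v) = f z :=
  hf fun i hi => Function.update_of_ne (by rintro rfl; exact hi hq) _ _

/-- The qubits of the CCZ state of the node `j`, and the ancilla that becomes a copy of the third of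
them. -/
def nodeQubits (K : ℕ) (w : ℕ → Q) (j : ℕ) : Set Q :=
  {w (2 * j), w (2 * j + 1), w (2 * K + j), w (3 * K + j)}

/-- Up to normalization, the amplitude of the CCZ state of the node `j` and of the ancilla, in the
state `|0⟩`, that becomes a copy of its third qubit. -/
def nodeAmp (K : ℕ) (w : ℕ → Q) (j : ℕ) : State Q := fun z =>
  overlap (z (w (3 * K + j))) false *
    sgn (z (w (2 * K + j)) && (z (w (2 * j)) && z (w (2 * j + 1))))

theorem exists_execState_eraseProduct (γ : ℝ) (ω : ℕ → Bool) {m : ℕ → Bool}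
    (hw : Set.InjOn w (Set.Iio (4 * K))) (hj : 1 ≤ j) (hjK : j < K)
    (hm : Fresh m (eraseProduct K w j).ops) :
    ∃ χ : Bool → ℂ, ∀ Φ : State Q, execState γ ω (eraseProduct K w j).ops m Φ = fun z =>
      χ (z (w (2 * K + j))) * ∑ v, sgn (v &&
        xor (execMemory ω (eraseProduct K w j).ops m (bit .upOutcome (2 * j + 1)))
          (m (bit .frame (2 * j)) && z (w (2 * j + 1)))) *
        Φ (Function.update z (w (2 * K + j)) v) :=
  exists_execState_erase γ ω (wire_ne hw (by omega) (by omega) (by omega)) (by simp) hm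

theorem exists_execState_eraseCopy (γ : ℝ) (ω : ℕ → Bool) {m : ℕ → Bool}
    (hw : Set.InjOn w (Set.Iio (4 * K))) (hjK : j < K) (hm : Fresh m (eraseCopy K w j).ops) :
    ∃ χ : Bool → ℂ, ∀ Φ : State Q, execState γ ω (eraseCopy K w j).ops m Φ = fun z =>
      χ (z (w (3 * K + j))) * ∑ v, sgn (v &&
        xor (execMemory ω (eraseCopy K w j).ops m (bit .upOutcome (2 * j)))
          (m (bit .frame (2 * j + 1)) && z (w (2 * j)))) *
        Φ (Function.update z (w (3 * K + j)) v) :=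
  exists_execState_erase γ ω (wire_ne hw (by omega) (by omega) (by omega)) (by simp) hm

/-- The pending frames of the children of the node `j` make the erasures of the CCZ qubit and of
its copy contribute linear terms; the sum over the common value of the two yields an exact AND. -/
theorem exists_execState_eraseBoth (γ : ℝ) (ω : ℕ → Bool) {m : ℕ → Bool}
    (hw : Set.InjOn w (Set.Iio (4 * K))) (hj : 1 ≤ j) (hjK : j < K)
    (hm : Fresh m (eraseBoth K w j)) :
    ∃ χ : Bool → Bool → ℂ, ∀ D : State Q, DependsOn D {w (2 * K + j), w (3 * K + j)}ᶜ →
      execState γ ω (eraseBoth K w j) m (fun z =>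
        overlap (z (w (2 * K + j))) (z (w (3 * K + j))) * sgn (z (w (3 * K + j)) && z (w j)) / 2 *
          (D z * sgn (z (w (2 * K + j)) && (z (w (2 * j)) && z (w (2 * j + 1)))))) = fun z =>
        χ (z (w (2 * K + j))) (z (w (3 * K + j))) * D z * overlap (z (w j))
          (xor (z (w (2 * j)) && z (w (2 * j + 1)))
            (xor (xor (execMemory ω (eraseBoth K w j) m (bit .upOutcome (2 * j)))
                (execMemory ω (eraseBoth K w j) m (bit .upOutcome (2 * j + 1))))
              (xor (m (bit .frame (2 * j)) && z (w (2 * j + 1)))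
                (m (bit .frame (2 * j + 1)) && z (w (2 * j)))))) := by
  have hpc : w (2 * K + j) ≠ w (3 * K + j) := wire_ne hw (by omega) (by omega) (by omega)
  have htc : w j ≠ w (3 * K + j) := wire_ne hw (by omega) (by omega) (by omega)
  have htp : w j ≠ w (2 * K + j) := wire_ne hw (by omega) (by omega) (by omega)
  have hxc : w (2 * j) ≠ w (3 * K + j) := wire_ne hw (by omega) (by omega) (by omega)
  have hxp : w (2 * j) ≠ w (2 * K + j) := wire_ne hw (by omega) (by omega) (by omega)
  have hyc : w (2 * j + 1) ≠ w (3 * K + j) := wire_ne hw (by omega) (by omega) (by omega)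
  have hyp : w (2 * j + 1) ≠ w (2 * K + j) := wire_ne hw (by omega) (by omega) (by omega)
  rw [execMemory_eraseBoth]
  have hm' : Fresh _ (eraseCopy K w j).ops := hm.execMemory
    (by simp [eraseProduct, eraseCopy, erase, Round.ops, Op.writes]) ω
  obtain ⟨χ₁, h₁⟩ := exists_execState_eraseProduct γ ω hw hj hjK hm.of_append_left
  obtain ⟨χ₂, h₂⟩ := exists_execState_eraseCopy γ ω hw hjK hm'
  refine ⟨fun u v => χ₁ u * χ₂ v, fun D hD => funext fun z => ?_⟩
  have hDp (z v) : D (Function.update z (w (2 * K + j)) v) = D z :=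
    update_of_dependsOn hD (by simp) z v
  have hDc (z v) : D (Function.update z (w (3 * K + j)) v) = D z :=
    update_of_dependsOn hD (by simp) z v
  rw [eraseBoth, execState_append, execMemory_append, Module.End.mul_apply, h₁, h₂]
  simp only [execMemory_eraseProduct_frame, Fintype.sum_bool, Function.update_self,
    Function.update_of_ne hpc, Function.update_of_ne hpc.symm, Function.update_of_ne htc,
    Function.update_of_ne htp, Function.update_of_ne hxc, Function.update_of_ne hxp,
    Function.update_of_ne hyc, Function.update_of_ne hyp, hDp, hDc]
  simp only [overlap_eq_div_two, sgn_xor, Bool.true_and, Bool.false_and, Bool.xor_self,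
    Bool.xor_false, Bool.false_xor, sgn_false, sgn_true]
  ring

theorem execState_updateFrames (γ : ℝ) (ω m : ℕ → Bool) (Φ : State Q) :
    execState γ ω (updateFrames w j).ops m Φ = fun z =>
      let z' := Function.update z (w (2 * j + 1))
        (xor (z (w (2 * j + 1))) (m (bit .frame (2 * j + 1))))
      Φ (Function.update z' (w (2 * j)) (xor (z' (w (2 * j))) (m (bit .frame (2 * j))))) := by
  funext z
  simp only [updateFrames, Round.ops, execState, Op.effect, List.map_nil, List.reverse_nil,
    List.prod_nil, one_mul, mul_one, Module.End.mul_apply, ite_X_apply]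
  rfl

theorem exists_execState_andGate (γ : ℝ) (ω : ℕ → Bool) {m : ℕ → Bool}
    (hw : Set.InjOn w (Set.Iio (4 * K))) (hj : 1 ≤ j) (hjK : j < K)
    (hm : Fresh m (couple K w j ++ eraseBoth K w j)) :
    ∃ χ : Bool → Bool → ℂ, ∀ D : State Q, DependsOn D {w (2 * K + j), w (3 * K + j)}ᶜ →
      execState γ ω (couple K w j ++ eraseBoth K w j) m (fun z => D z * nodeAmp K w j z) =
        fun z => χ (z (w (2 * K + j))) (z (w (3 * K + j))) * D z * overlap (z (w j))
          (xor (xor (z (w (2 * j))) (m (bit .frame (2 * j))) &&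
              xor (z (w (2 * j + 1))) (m (bit .frame (2 * j + 1))))
            (execMemory ω (upNode K w j) m (bit .frame j))) := by
  have hpc : w (2 * K + j) ≠ w (3 * K + j) := wire_ne hw (by omega) (by omega) (by omega)
  have htc : w j ≠ w (3 * K + j) := wire_ne hw (by omega) (by omega) (by omega)
  have hxc : w (2 * j) ≠ w (3 * K + j) := wire_ne hw (by omega) (by omega) (by omega)
  have hyc : w (2 * j + 1) ≠ w (3 * K + j) := wire_ne hw (by omega) (by omega) (by omega)
  obtain ⟨χ, h⟩ := exists_execState_eraseBoth γ ω hw hj hjK (hm.execMemory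
    (by simp [couple, eraseBoth, attachTarget, attachSource, eraseProduct, eraseCopy, erase,
      Round.ops, Op.writes]) ω)
  refine ⟨χ, fun D hD => ?_⟩
  have hamp : (fun z => D z * nodeAmp K w j z) = fun z => overlap (z (w (3 * K + j))) false *
      (D z * sgn (z (w (2 * K + j)) && (z (w (2 * j)) && z (w (2 * j + 1))))) := by
    funext z
    rw [nodeAmp]
    ring
  rw [execState_append, hamp, Module.End.mul_apply, couple, execState_attach _ _ _ _ _ _ hpc htc,
    ← couple, h D hD, execMemory_upNode_frame, execMemory_append]
  · funext z
    rw [execMemory_couple_frame, execMemory_couple_frame]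
    congr 2
    generalize execMemory ω (eraseBoth K w j) _ (bit .upOutcome (2 * j)) = o₁,
      execMemory ω (eraseBoth K w j) _ (bit .upOutcome (2 * j + 1)) = o₂
    cases m (bit .frame (2 * j)) <;> cases m (bit .frame (2 * j + 1)) <;> cases z (w (2 * j)) <;>
      cases z (w (2 * j + 1)) <;> cases o₁ <;> cases o₂ <;> rfl
  · intro z v
    simp only [Function.update_of_ne hpc, Function.update_of_ne hxc, Function.update_of_ne hyc,
      update_of_dependsOn hD (Set.mem_insert_of_mem _ rfl)]

theorem exists_execState_upNode (γ : ℝ) (ω : ℕ → Bool) {m : ℕ → Bool}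
    (hw : Set.InjOn w (Set.Iio (4 * K))) (hj : 1 ≤ j) (hjK : j < K)
    (hm : Fresh m (upNode K w j)) :
    ∃ χ : Bool → Bool → ℂ, ∀ {E : State Q} {a b : (Q → Bool) → Bool},
      DependsOn E (nodeQubits K w j)ᶜ →
      DependsOn a (nodeQubits K w j)ᶜ →
      DependsOn b (nodeQubits K w j)ᶜ →
      execState γ ω (upNode K w j) m (fun z => E z *
          (overlap (z (w (2 * j))) (xor (a z) (m (bit .frame (2 * j)))) *
            overlap (z (w (2 * j + 1))) (xor (b z) (m (bit .frame (2 * j + 1))))) *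
          nodeAmp K w j z) = fun z =>
        χ (z (w (2 * K + j))) (z (w (3 * K + j))) * E z *
          (overlap (z (w (2 * j))) (a z) * overlap (z (w (2 * j + 1))) (b z)) *
          overlap (z (w j)) (xor (a z && b z) (execMemory ω (upNode K w j) m (bit .frame j))) := by
  have hyx : w (2 * j + 1) ≠ w (2 * j) := wire_ne hw (by omega) (by omega) (by omega)
  have htx : w j ≠ w (2 * j) := wire_ne hw (by omega) (by omega) (by omega)
  have hty : w j ≠ w (2 * j + 1) := wire_ne hw (by omega) (by omega) (by omega)
  have hpx : w (2 * K + j) ≠ w (2 * j) := wire_ne hw (by omega) (by omega) (by omega)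
  have hpy : w (2 * K + j) ≠ w (2 * j + 1) := wire_ne hw (by omega) (by omega) (by omega)
  have hcx : w (3 * K + j) ≠ w (2 * j) := wire_ne hw (by omega) (by omega) (by omega)
  have hcy : w (3 * K + j) ≠ w (2 * j + 1) := wire_ne hw (by omega) (by omega) (by omega)
  obtain ⟨χ, h⟩ := exists_execState_andGate γ ω hw hj hjK hm.of_append_left
  refine ⟨χ, fun {E a b} hE ha hb => ?_⟩
  have hD : DependsOn (fun z => E z *
      (overlap (z (w (2 * j))) (xor (a z) (m (bit .frame (2 * j)))) *
        overlap (z (w (2 * j + 1))) (xor (b z) (m (bit .frame (2 * j + 1))))))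
      {w (2 * K + j), w (3 * K + j)}ᶜ := fun z z' h => by
    have hT (q) (hq : q ∈ (nodeQubits K w j)ᶜ) : z q = z' q := h q (by simp_all [nodeQubits])
    simp only [hE hT, ha hT, hb hT, h (w (2 * j)) (by simp [hpx.symm, hcx.symm]),
      h (w (2 * j + 1)) (by simp [hpy.symm, hcy.symm])]
  have hx : w (2 * j) ∈ nodeQubits K w j := by simp [nodeQubits]
  have hy : w (2 * j + 1) ∈ nodeQubits K w j := by simp [nodeQubits]
  rw [upNode, execState_append, Module.End.mul_apply, h _ hD, execState_updateFrames]
  funext z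
  simp only [execMemory_andGate_frame, Function.update_self, Function.update_of_ne hyx,
    Function.update_of_ne hyx.symm, Function.update_of_ne htx, Function.update_of_ne hty,
    Function.update_of_ne hpx, Function.update_of_ne hpy, Function.update_of_ne hcx,
    Function.update_of_ne hcy, update_of_dependsOn hE hx, update_of_dependsOn hE hy,
    update_of_dependsOn ha hx, update_of_dependsOn ha hy, update_of_dependsOn hb hx,
    update_of_dependsOn hb hy, overlap_xor, Bool.bne_assoc, Bool.xor_self, Bool.xor_false]
  rw [← upNode]
  cases z (w (2 * j)) <;> cases a z <;> cases z (w (2 * j + 1)) <;> cases b z <;> simp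

theorem exists_execState_downNode (γ : ℝ) (ω : ℕ → Bool) {m : ℕ → Bool}
    (hxy : w (2 * j) ≠ w (2 * j + 1)) (hm : Fresh m (downNode w j)) :
    ∃ χ : Bool → Bool → ℂ, ∀ {E : State Q} {a b : (Q → Bool) → Bool},
      DependsOn E {w (2 * j), w (2 * j + 1)}ᶜ →
      DependsOn a {w (2 * j), w (2 * j + 1)}ᶜ →
      DependsOn b {w (2 * j), w (2 * j + 1)}ᶜ →
      execState γ ω (downNode w j) m (fun z => E z * sgn (m (bit .sign j) && (a z && b z)) *
          (overlap (z (w (2 * j))) (a z) * overlap (z (w (2 * j + 1))) (b z))) = fun z =>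
        χ (z (w (2 * j))) (z (w (2 * j + 1))) * E z *
          (sgn (execMemory ω (downNode w j) m (bit .sign (2 * j)) && a z) *
            sgn (execMemory ω (downNode w j) m (bit .sign (2 * j + 1)) && b z)) := by
  obtain ⟨χ, h⟩ := exists_execState_erase γ ω hxy (by simp [show j ≠ 2 * j + 1 by omega])
    hm.of_append_left
  refine ⟨fun u v => sgn (u && ω (bit .sign (2 * j))) / 2 * χ v, fun {E a b} hE ha hb => ?_⟩
  have hx : w (2 * j) ∈ ({w (2 * j), w (2 * j + 1)} : Set Q) := by simp
  have hy : w (2 * j + 1) ∈ ({w (2 * j), w (2 * j + 1)} : Set Q) := by simp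
  have hs : execMemory ω (downNode w j) m (bit .sign (2 * j + 1)) =
      execMemory ω (eraseRight w j).ops m (bit .sign (2 * j + 1)) := by
    rw [downNode, execMemory_append, execMemory_of_notMem_writes]
    simp [measureLeft, Round.ops, Op.writes]
  have ht : execMemory ω (downNode w j) m (bit .sign (2 * j)) = ω (bit .sign (2 * j)) := by
    simp [downNode, measureLeft, Round.ops, Op.memory, execMemory]
  rw [hs, ht, downNode, execState_append, Module.End.mul_apply, eraseRight, h]
  simp only [measureLeft, Round.ops, execState, Op.effect, List.map_nil, List.reverse_nil,
    List.prod_nil, one_mul, mul_one]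
  funext z
  rw [projOp_X_apply]
  simp only [Fintype.sum_bool, Function.update_self, Function.update_of_ne hxy,
    Function.update_of_ne hxy.symm, update_of_dependsOn hE hx, update_of_dependsOn hE hy,
    update_of_dependsOn ha hx, update_of_dependsOn ha hy, update_of_dependsOn hb hx,
    update_of_dependsOn hb hy, Bool.true_and, Bool.false_and, sgn_xor, sgn_false]
  cases a z <;> cases b z <;> cases m (bit .sign j) <;> simp <;> ring

end Effect

/-! ### The schedule -/

section Locality

variable {Q : Type} {K : ℕ} {w : ℕ → Q} {j : ℕ}

/-- The node to which a classical bit belongs. -/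
def bitNode (b : ℕ) : ℕ := (Nat.unpair b).2

@[simp] theorem bitNode_bit (s : BitKind) (j : ℕ) : bitNode (bit s j) = j := by
  rw [bitNode, bit, Nat.unpair_pair]

/-- The node `j` and its children. -/
def family (j : ℕ) : Set ℕ := {j, 2 * j, 2 * j + 1}

/-- The qubits of the node `j`, of its children and of its CCZ state. -/
def familyQubits (K : ℕ) (w : ℕ → Q) (j : ℕ) : Set Q := w '' (family j ∪ {2 * K + j, 3 * K + j})

/-- The instruction uses only qubits and classical bits of the node `j` and its children, apart from
reading the bit `idle`, which is assigned to the node `0`. -/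
structure Op.LocalAt (K : ℕ) (w : ℕ → Q) (j : ℕ) (o : Op Q ℕ) : Prop where
  qubits : ∀ q ∈ o.qubits, q ∈ familyQubits K w j
  reads : ∀ b ∈ o.reads, bitNode b ∈ insert 0 (family j)
  writes : ∀ b ∈ o.writes, bitNode b ∈ family j

theorem localAt_of_mem_upRounds : ∀ o ∈ sequential (upRounds K w) j, o.LocalAt K w j := by
  intro o ho
  simp only [sequential, upRounds, Round.par, Round.ops, attachTarget, attachSource, eraseProduct,
    eraseCopy, updateFrames, erase, List.flatMap_cons, List.flatMap_nil, List.cons_append,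
    List.nil_append, List.append_nil, List.mem_cons, List.not_mem_nil, or_false] at ho
  rcases ho with rfl | rfl | rfl | rfl | rfl | rfl | rfl | rfl | rfl | rfl | rfl | rfl | rfl |
    rfl | rfl | rfl | rfl | rfl | rfl <;> constructor <;>
    simp [Op.qubits, Op.reads, Op.writes, familyQubits, family, Set.image_insert_eq]

theorem localAt_of_mem_downRounds : ∀ o ∈ sequential (downRounds w) j, o.LocalAt K w j := by
  intro o ho
  simp only [sequential, downRounds, Round.par, Round.ops, eraseRight, measureLeft, erase,
    List.flatMap_cons, List.flatMap_nil, List.cons_append, List.nil_append, List.append_nil,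
    List.mem_cons, List.not_mem_nil, or_false] at ho
  rcases ho with rfl | rfl | rfl | rfl | rfl | rfl <;> constructor <;>
    simp [Op.qubits, Op.reads, Op.writes, familyQubits, family, Set.image_insert_eq]

/-- Neither of the two nodes is the other one or one of its children. -/
def Unrelated (i j : ℕ) : Prop := 0 < i ∧ 0 < j ∧ i ≠ j ∧ i < 2 * j ∧ j < 2 * i

theorem Unrelated.disjoint_family {i : ℕ} (h : Unrelated i j) :
    Disjoint (family i) (family j) := by
  simp only [Unrelated, family, Set.disjoint_insert_left, Set.disjoint_singleton_left,
    Set.mem_insert_iff, Set.mem_singleton_iff] at h ⊢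
  omega

theorem Unrelated.disjoint_familyQubits (hw : Set.InjOn w (Set.Iio (4 * K))) {i : ℕ} (hi : i < K)
    (hj : j < K) (h : Unrelated i j) : Disjoint (familyQubits K w i) (familyQubits K w j) := by
  rw [Set.disjoint_left]
  rintro _ ⟨a, ha, rfl⟩ ⟨b, hb, e⟩
  simp only [Unrelated, family, Set.mem_union, Set.mem_insert_iff,
    Set.mem_singleton_iff] at h ha hb
  have := hw (Set.mem_Iio.2 (by omega)) (Set.mem_Iio.2 (by omega)) e
  omega

theorem Op.LocalAt.indep (hw : Set.InjOn w (Set.Iio (4 * K))) {i : ℕ} {o o' : Op Q ℕ}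
    (hi : i < K) (hj : j < K) (hij : Unrelated i j) (h : o.LocalAt K w i)
    (h' : o'.LocalAt K w j) : o.Indep o' := by
  have hdisj := Set.disjoint_left.1 hij.disjoint_family
  have h0i : 0 ∉ family i := by simp [family, hij.1.ne, hij.1.ne']
  have h0j : 0 ∉ family j := by simp [family, hij.2.1.ne, hij.2.1.ne']
  refine ⟨fun q hq hq' => Set.disjoint_left.1 (hij.disjoint_familyQubits hw hi hj)
    (h.qubits q hq) (h'.qubits q hq'), fun b hb hb' => ?_, fun b hb hb' => ?_, fun b hb hb' =>
    hdisj (h.writes b hb) (h'.writes b hb')⟩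
  · rcases h.reads b hb with h₀ | hb
    · exact h0j (h₀ ▸ h'.writes b hb')
    · exact hdisj hb (h'.writes b hb')
  · rcases h'.reads b hb' with h₀ | hb'
    · exact h0i (h₀ ▸ h.writes b hb)
    · exact hdisj (h.writes b hb) hb'

end Locality

section Nodes

variable {Q : Type} [DecidableEq Q] {K : ℕ} {w : ℕ → Q} {j : ℕ}

theorem sequential_upRounds_reorders (hw : Set.InjOn w (Set.Iio (4 * K))) (hj : 1 ≤ j)
    (hjK : j < K) : Reorders (sequential (upRounds K w) j) (upNode K w j) := by
  have hpc : w (2 * K + j) ≠ w (3 * K + j) := wire_ne hw (by omega) (by omega) (by omega)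
  have hyx : w (2 * j + 1) ≠ w (2 * j) := wire_ne hw (by omega) (by omega) (by omega)
  have hpx : w (2 * K + j) ≠ w (2 * j) := wire_ne hw (by omega) (by omega) (by omega)
  have hyc : w (2 * j + 1) ≠ w (3 * K + j) := wire_ne hw (by omega) (by omega) (by omega)
  have herase : (eraseProduct K w j).Precedes (eraseCopy K w j) := by
    refine ⟨by simp [eraseProduct, eraseCopy, erase], ?_⟩
    simp only [eraseProduct, eraseCopy, erase, List.mem_cons, List.not_mem_nil, or_false,
      forall_eq_or_imp, forall_eq]
    refine ⟨?_, ?_, ?_, ?_⟩ <;> constructor <;>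
      simp [Op.qubits, Op.reads, Op.writes, hpc, hyx, hpx, hyc]
  have hpar : Reorders (Round.par [eraseProduct K w j, eraseCopy K w j, updateFrames w j]).ops
      (eraseBoth K w j ++ (updateFrames w j).ops) := by
    refine (Round.par_reorders ?_).trans (by simpa [eraseBoth] using .refl _)
    simp [herase, Round.Precedes.of_pairs_eq_nil (r' := updateFrames w j) rfl]
  have hcouple : sequential (upRounds K w) j = couple K w j ++
      (Round.par [eraseProduct K w j, eraseCopy K w j, updateFrames w j]).ops := by
    simp [sequential, upRounds, couple]
  rw [hcouple, upNode, List.append_assoc]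
  exact (Reorders.refl _).append hpar

theorem sequential_downRounds_reorders : Reorders (sequential (downRounds w) j) (downNode w j) := by
  have hpar : Reorders (Round.par [eraseRight w j, measureLeft w j]).ops (downNode w j) := by
    refine (Round.par_reorders ?_).trans (by simpa [downNode] using .refl _)
    simp [Round.Precedes.of_pairs_eq_nil (r' := measureLeft w j) rfl]
  simpa [sequential, downRounds] using hpar

theorem Reorders.of_localAt (hw : Set.InjOn w (Set.Iio (4 * K))) {fs : List (ℕ → Round Q ℕ)}
    {N : List ℕ} {g : ℕ → List (Op Q ℕ)} (hN : ∀ j ∈ N, j < K) (hunrel : N.Pairwise Unrelated)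
    (hlocal : ∀ j ∈ N, ∀ o ∈ sequential fs j, o.LocalAt K w j)
    (hg : ∀ j ∈ N, Reorders (sequential fs j) (g j)) :
    Reorders ((parallel fs N).flatMap Round.ops) (N.flatMap g) :=
  (parallel_reorders fs (hunrel.imp_of_mem fun hi hj hij o ho o' ho' =>
    (hlocal _ hi o ho).indep hw (hN _ hi) (hN _ hj) hij (hlocal _ hj o' ho'))).trans
    (.flatMap N hg)

end Nodes

section Levels

/-- The internal nodes of depth `d` of the tree with `K` leaves. -/
def nodes (K d : ℕ) : List ℕ :=
  List.range' (min (2 ^ d) K) (min (2 ^ (d + 1)) K - min (2 ^ d) K)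

theorem mem_nodes {K d j : ℕ} : j ∈ nodes K d ↔ 2 ^ d ≤ j ∧ j < 2 ^ (d + 1) ∧ j < K := by
  rw [nodes, List.mem_range'_1]
  have : 2 ^ d ≤ 2 ^ (d + 1) := Nat.pow_le_pow_right (by norm_num) (by omega)
  omega

theorem flatMap_nodes {K : ℕ} (hK : 1 ≤ K) (L : ℕ) :
    (List.range L).flatMap (nodes K) = List.range' 1 (min (2 ^ L) K - 1) := by
  induction L with
  | zero => simp [hK]
  | succ L ih =>
    rw [List.range_succ, List.flatMap_append, ih, List.flatMap_singleton, nodes]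
    have hpos : 1 ≤ 2 ^ L := Nat.one_le_two_pow
    have hle : 2 ^ L ≤ 2 ^ (L + 1) := Nat.pow_le_pow_right (by norm_num) (by omega)
    have happend := List.range'_append_1 (s := 1) (m := min (2 ^ L) K - 1)
      (n := min (2 ^ (L + 1)) K - min (2 ^ L) K)
    rw [show 1 + (min (2 ^ L) K - 1) = min (2 ^ L) K by omega] at happend
    rw [happend, ← Nat.sub_add_comm (le_min hpos hK), Nat.add_sub_cancel' (min_le_min_right K hle)]

theorem pairwise_unrelated_nodes (K d : ℕ) : (nodes K d).Pairwise Unrelated :=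
  List.Nodup.pairwise_of_forall_ne List.nodup_range' fun i hi j hj hij => by
    have hi := mem_nodes.1 hi
    have hj := mem_nodes.1 hj
    have : 0 < 2 ^ d := by positivity
    rw [pow_succ] at hi hj
    exact ⟨by omega, by omega, hij, by omega, by omega⟩

theorem Unrelated.symm {i j : ℕ} (h : Unrelated i j) : Unrelated j i := by
  rw [Unrelated] at *
  omega

end Levels

section Schedule

variable {Q : Type} (K : ℕ) (w : ℕ → Q)

/-- The computation of the values of the nodes from the last one to the node `i`. -/
def upProgram (i : ℕ) : List (Op Q ℕ) := (List.range' i (K - i)).reverse.flatMap (upNode K w)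

/-- The removal of the children of all nodes before `i`. -/
def downProgram (i : ℕ) : List (Op Q ℕ) := (List.range' 1 (i - 1)).flatMap (downNode w)

/-- The computation of the values of all nodes, level by level. -/
def upLevels (L : ℕ) : List (Round Q ℕ) :=
  (List.range L).reverse.flatMap fun d => parallel (upRounds K w) (nodes K d).reverse

/-- The removal of the children of all nodes, level by level. -/
def downLevels (L : ℕ) : List (Round Q ℕ) :=
  (List.range L).flatMap fun d => parallel (downRounds w) (nodes K d)

variable {K w}

theorem upProgram_one_eq (hK : 1 ≤ K) {L : ℕ} (hL : K ≤ 2 ^ L) : upProgram K w 1 =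
    (List.range L).reverse.flatMap fun d => (nodes K d).reverse.flatMap (upNode K w) := by
  have hnodes := flatMap_nodes hK L
  rw [min_eq_right hL] at hnodes
  rw [upProgram, ← hnodes, List.reverse_flatMap, List.flatMap_assoc]
  rfl

theorem downProgram_eq (hK : 1 ≤ K) {L : ℕ} (hL : K ≤ 2 ^ L) : downProgram w K =
    (List.range L).flatMap fun d => (nodes K d).flatMap (downNode w) := by
  have hnodes := flatMap_nodes hK L
  rw [min_eq_right hL] at hnodes
  rw [downProgram, ← hnodes, List.flatMap_assoc]

theorem lt_of_mem_nodes {d j : ℕ} (hj : j ∈ nodes K d) : j < K := (mem_nodes.1 hj).2.2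

theorem pos_of_mem_nodes {d j : ℕ} (hj : j ∈ nodes K d) : 1 ≤ j :=
  Nat.one_le_two_pow.trans (mem_nodes.1 hj).1

theorem upLevels_reorders [DecidableEq Q] (hw : Set.InjOn w (Set.Iio (4 * K))) (hK : 1 ≤ K) {L : ℕ}
    (hL : K ≤ 2 ^ L) : Reorders ((upLevels K w L).flatMap Round.ops) (upProgram K w 1) := by
  rw [upLevels, List.flatMap_assoc, upProgram_one_eq hK hL]
  refine .flatMap _ fun d _ => .of_localAt hw (fun j hj => ?_) ?_
    (fun j _ => localAt_of_mem_upRounds) fun j hj => ?_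
  · exact lt_of_mem_nodes (List.mem_reverse.1 hj)
  · exact List.pairwise_reverse.2 ((pairwise_unrelated_nodes K d).imp .symm)
  · have hj := List.mem_reverse.1 hj
    exact sequential_upRounds_reorders hw (pos_of_mem_nodes hj) (lt_of_mem_nodes hj)

theorem downLevels_reorders [DecidableEq Q] (hw : Set.InjOn w (Set.Iio (4 * K))) (hK : 1 ≤ K)
    {L : ℕ} (hL : K ≤ 2 ^ L) :
    Reorders ((downLevels K w L).flatMap Round.ops) (downProgram w K) := by
  rw [downLevels, List.flatMap_assoc, downProgram_eq hK hL]
  exact .flatMap _ fun d _ => .of_localAt hw (fun j => lt_of_mem_nodes)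
    (pairwise_unrelated_nodes K d) (fun j _ => localAt_of_mem_downRounds)
    fun j _ => sequential_downRounds_reorders

end Schedule

section Circuit

variable {Q : Type} {K : ℕ} (x : Fin K → Q) (w : ℕ → Q) (L : ℕ)

/-- The measurements that attach the data qubits to the leaves `w (K + i)` of the tree. -/
def attachLeaves : Round Q ℕ where
  pairs := (List.finRange K).map fun i =>
    ⟨x i, w (K + i), fun _ => some (.Z, .Z), bit .idle 0, bit .frame (K + i)⟩
  rest := []

/-- The correction of the root of the tree, the phase gate, and the removal of the root. -/
def rootOps : List (Op Q ℕ) :=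
  [.gate .X (w 1) (bit .frame 1), .phase (w 1),
    .meas (w 1) (fun _ => some .X) (bit .idle 0) (bit .sign 1)]

/-- The instructions of the circuit with data qubits `x` and ancillas `w`, node by node. -/
def circuitProgram : List (Op Q ℕ) :=
  (attachLeaves x w).ops ++ upProgram K w 1 ++ rootOps w ++ downProgram w K

/-- The rounds of the circuit before the phase gate. -/
def roundsBefore : List (Round Q ℕ) :=
  (upLevels K w L).modifyHead fun r => Round.par [attachLeaves x w, r]

/-- The instructions of the circuit with data qubits `x` and ancillas `w`, level by level. -/
def circuitOps : List (Op Q ℕ) :=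
  (roundsBefore x w L).flatMap Round.ops ++ rootOps w ++ (downLevels K w L).flatMap Round.ops

variable {x w L}

theorem exists_upLevels_succ (K : ℕ) (w : ℕ → Q) (L : ℕ) : ∃ rs, upLevels K w (L + 1) =
    Round.par ((nodes K L).reverse.map fun j =>
      attachTarget (w (3 * K + j)) (w j) (bit .idle 0) (bit .attachTarget j)) :: rs :=
  ⟨_, by rw [upLevels, List.range_succ, List.reverse_append]; rfl⟩

theorem exists_roundsBefore (x : Fin K → Q) (w : ℕ → Q) (hL : 1 ≤ L) :
    ∃ r rs, upLevels K w L = r :: rs ∧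
      roundsBefore x w L = Round.par [attachLeaves x w, r] :: rs ∧
      ∀ p ∈ r.pairs, p.ctrl = bit .idle 0 ∧ ∃ j < K, p.fst = w (3 * K + j) ∧ p.snd = w j := by
  obtain ⟨L, rfl⟩ : ∃ L', L = L' + 1 := ⟨L - 1, by omega⟩
  obtain ⟨rs, hrs⟩ := exists_upLevels_succ K w L
  refine ⟨_, rs, hrs, by rw [roundsBefore, hrs, List.modifyHead_cons], fun p hp => ?_⟩
  obtain ⟨r, hr, hp⟩ := List.mem_flatMap.1 hp
  obtain ⟨j, hj, rfl⟩ := List.mem_map.1 hr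
  obtain rfl := List.mem_singleton.1 hp
  exact ⟨rfl, j, lt_of_mem_nodes (List.mem_reverse.1 hj), rfl, rfl⟩

theorem roundsBefore_reorders [DecidableEq Q] (hL : 1 ≤ L) :
    Reorders ((roundsBefore x w L).flatMap Round.ops)
      ((attachLeaves x w).ops ++ (upLevels K w L).flatMap Round.ops) := by
  obtain ⟨r, rs, hr, hrs, hctrl⟩ := exists_roundsBefore x w hL
  have hprecedes : (attachLeaves x w).Precedes r := by
    refine ⟨fun p hp p' hp' => ?_, by simp [attachLeaves]⟩
    obtain ⟨i, -, rfl⟩ := List.mem_map.1 hp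
    simp [(hctrl p' hp').1]
  rw [hr, hrs, List.flatMap_cons, List.flatMap_cons, ← List.append_assoc]
  refine ((Round.par_reorders ?_).trans ?_).append (.refl _)
  · simpa using hprecedes
  · simpa using .refl _

theorem circuitOps_reorders [DecidableEq Q] (hw : Set.InjOn w (Set.Iio (4 * K))) (hK : 1 ≤ K)
    (hL : 1 ≤ L) (hKL : K ≤ 2 ^ L) : Reorders (circuitOps x w L) (circuitProgram x w) :=
  have hbefore := (roundsBefore_reorders hL).trans
    ((Reorders.refl (attachLeaves x w).ops).append (upLevels_reorders hw hK hKL))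
  (hbefore.append (.refl _)).append (downLevels_reorders hw hK hKL)

end Circuit

/-! ### Well-formedness of the circuit -/

section Writes

variable {Q : Type} {K : ℕ} {x : Fin K → Q} {w : ℕ → Q} {L : ℕ}

theorem writes_circuitProgram (x : Fin K → Q) (w : ℕ → Q) :
    (circuitProgram x w).flatMap Op.writes =
      ((List.finRange K).map fun i : Fin K => bit .frame (K + i)) ++
        (List.range' 1 (K - 1)).reverse.flatMap upBits ++ [bit .sign 1] ++
        (List.range' 1 (K - 1)).flatMap downBits := by
  have hup : (fun j => (upNode K w j).flatMap Op.writes) = upBits :=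
    funext fun j => writes_upNode K w j
  have hdown : (fun j => (downNode w j).flatMap Op.writes) = downBits :=
    funext fun j => writes_downNode w j
  simp only [circuitProgram, upProgram, downProgram, List.flatMap_append, List.flatMap_assoc, hup,
    hdown, attachLeaves, Round.ops, rootOps, Op.writes, List.flatMap_cons, List.flatMap_nil,
    List.map_map, Function.comp_def, List.append_nil, List.nil_append]

theorem nodup_flatMap_upBits (K : ℕ) :
    ((List.range' 1 (K - 1)).reverse.flatMap upBits).Nodup :=
  List.nodup_flatMap.2 ⟨fun j _ => nodup_upBits j, (List.nodup_reverse.2 List.nodup_range').imp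
    fun {i j} hij => by
      simp only [Function.onFun, List.disjoint_left, upBits, List.mem_cons, List.not_mem_nil,
        or_false, forall_eq_or_imp, forall_eq, bit_inj, reduceCtorEq, false_and, false_or,
        true_and]
      omega⟩

theorem nodup_flatMap_downBits (K : ℕ) :
    ((List.range' 1 (K - 1)).flatMap downBits).Nodup :=
  List.nodup_flatMap.2 ⟨fun j _ => nodup_downBits j, (List.nodup_range' (n := K - 1)).imp
    fun {i j} hij => by
      simp only [Function.onFun, List.disjoint_left, downBits, List.mem_cons, List.not_mem_nil,
        or_false, forall_eq_or_imp, forall_eq, bit_inj, reduceCtorEq, false_and, false_or,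
        true_and]
      omega⟩

theorem disjoint_upBits_downBits (i j : ℕ) : (upBits i).Disjoint (downBits j) := by
  simp [List.disjoint_left, upBits, downBits]

theorem nodup_writes_circuitProgram (x : Fin K → Q) (w : ℕ → Q) :
    ((circuitProgram x w).flatMap Op.writes).Nodup := by
  have hleaves : ((List.finRange K).map fun i : Fin K => bit .frame (K + i)).Nodup :=
    (List.nodup_finRange K).map fun i j h => by simpa [Fin.ext_iff] using h
  rw [writes_circuitProgram]
  refine List.nodup_append'.2 ⟨List.nodup_append'.2 ⟨List.nodup_append'.2
    ⟨hleaves, nodup_flatMap_upBits K, ?_⟩, List.nodup_singleton _, ?_⟩,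
    nodup_flatMap_downBits K, ?_⟩
  · simp only [List.disjoint_left, List.mem_map, List.mem_flatMap, List.mem_reverse,
      List.mem_range'_1, not_exists, not_and, forall_exists_index, and_imp]
    rintro _ i - rfl j - hjK
    simp only [upBits, List.mem_cons, bit_inj, reduceCtorEq, false_and, true_and, List.not_mem_nil,
      or_false, false_or]
    omega
  · simp [upBits]
  · intro b hb hb'
    obtain ⟨j, hj, hb'⟩ := List.mem_flatMap.1 hb'
    rcases List.mem_append.1 hb with hb | hb
    · rcases List.mem_append.1 hb with hb | hb
      · obtain ⟨i, -, rfl⟩ := List.mem_map.1 hb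
        simp [downBits] at hb'
      · obtain ⟨i, -, hb⟩ := List.mem_flatMap.1 hb
        exact disjoint_upBits_downBits i j hb hb'
    · have := (List.mem_range'_1.1 hj).1
      obtain rfl := List.mem_singleton.1 hb
      simp only [downBits, List.mem_cons, bit_inj, reduceCtorEq, false_and, true_and,
        List.not_mem_nil, or_false, false_or] at hb'
      omega

theorem nodup_writes_circuitOps (hw : Set.InjOn w (Set.Iio (4 * K))) (hK : 1 ≤ K) (hL : 1 ≤ L)
    (hKL : K ≤ 2 ^ L) : ((circuitOps x w L).flatMap Op.writes).Nodup := by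
  classical
  exact (circuitOps_reorders hw hK hL hKL).writes.nodup_iff.2 (nodup_writes_circuitProgram x w)

end Writes

section Qubits

variable {Q : Type} {K : ℕ} {w : ℕ → Q} {L : ℕ}

theorem nodup_qubits_merge_par (hw : Set.InjOn w (Set.Iio (4 * K))) {f : ℕ → Round Q ℕ}
    {N : List ℕ} (hN : ∀ j ∈ N, j < K) (hunrel : N.Pairwise Unrelated)
    (hlocal : ∀ j ∈ N, ∀ o ∈ (f j).ops, o.LocalAt K w j)
    (hnodup : ∀ j ∈ N, (Op.merge (f j).pairs).qubits.Nodup) :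
    (Op.merge (Round.par (N.map f)).pairs).qubits.Nodup := by
  rw [Round.par, List.flatMap_map, Op.qubits, List.flatMap_assoc]
  refine List.nodup_flatMap.2 ⟨hnodup, hunrel.imp_of_mem fun {i j} hi hj hij q hq hq' => ?_⟩
  exact Set.disjoint_left.1 (hij.disjoint_familyQubits hw (hN i hi) (hN j hj))
    ((hlocal i hi _ List.mem_cons_self).qubits q hq)
    ((hlocal j hj _ List.mem_cons_self).qubits q hq')

theorem nodup_qubits_upRounds (hw : Set.InjOn w (Set.Iio (4 * K))) {j : ℕ} (hj : 1 ≤ j)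
    (hjK : j < K) : ∀ f ∈ upRounds K w, (Op.merge (f j).pairs).qubits.Nodup := by
  have hcp : w (3 * K + j) ≠ w (2 * K + j) := wire_ne hw (by omega) (by omega) (by omega)
  have hct : w (3 * K + j) ≠ w j := wire_ne hw (by omega) (by omega) (by omega)
  have hpx : w (2 * K + j) ≠ w (2 * j) := wire_ne hw (by omega) (by omega) (by omega)
  have hpy : w (2 * K + j) ≠ w (2 * j + 1) := wire_ne hw (by omega) (by omega) (by omega)
  have hcx : w (3 * K + j) ≠ w (2 * j) := wire_ne hw (by omega) (by omega) (by omega)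
  have hyc : w (2 * j + 1) ≠ w (3 * K + j) := wire_ne hw (by omega) (by omega) (by omega)
  have hyx : w (2 * j + 1) ≠ w (2 * j) := wire_ne hw (by omega) (by omega) (by omega)
  simp [upRounds, attachTarget, attachSource, Round.par, eraseProduct, eraseCopy, updateFrames,
    erase, Op.qubits, hcp.symm, hct, hpx, hpy, hcx, hyc, hyx]

theorem nodup_qubits_downRounds (hw : Set.InjOn w (Set.Iio (4 * K))) {j : ℕ} (hjK : j < K) :
    ∀ f ∈ downRounds w, (Op.merge (f j).pairs).qubits.Nodup := by
  have hyx : w (2 * j + 1) ≠ w (2 * j) := wire_ne hw (by omega) (by omega) (by omega)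
  simp [downRounds, Round.par, eraseRight, measureLeft, erase, Op.qubits, hyx]

theorem nodup_qubits_upLevels (hw : Set.InjOn w (Set.Iio (4 * K))) :
    ∀ r ∈ upLevels K w L, (Op.merge r.pairs).qubits.Nodup := by
  intro r hr
  obtain ⟨d, -, hr⟩ := List.mem_flatMap.1 hr
  obtain ⟨f, hf, rfl⟩ := List.mem_map.1 hr
  refine nodup_qubits_merge_par hw (fun j hj => lt_of_mem_nodes (List.mem_reverse.1 hj))
    (List.pairwise_reverse.2 ((pairwise_unrelated_nodes K d).imp .symm))
    (fun j _ o ho => localAt_of_mem_upRounds o (List.mem_flatMap.2 ⟨f, hf, ho⟩)) fun j hj => ?_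
  have hj := List.mem_reverse.1 hj
  exact nodup_qubits_upRounds hw (pos_of_mem_nodes hj) (lt_of_mem_nodes hj) f hf

theorem nodup_qubits_downLevels (hw : Set.InjOn w (Set.Iio (4 * K))) :
    ∀ r ∈ downLevels K w L, (Op.merge r.pairs).qubits.Nodup := by
  intro r hr
  obtain ⟨d, -, hr⟩ := List.mem_flatMap.1 hr
  obtain ⟨f, hf, rfl⟩ := List.mem_map.1 hr
  exact nodup_qubits_merge_par hw (fun j hj => lt_of_mem_nodes hj) (pairwise_unrelated_nodes K d)
    (fun j _ o ho => localAt_of_mem_downRounds o (List.mem_flatMap.2 ⟨f, hf, ho⟩))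
    fun j hj => nodup_qubits_downRounds hw (lt_of_mem_nodes hj) f hf

theorem nodup_qubits_roundsBefore {x : Fin K → Q} (hx : Function.Injective x)
    (hw : Set.InjOn w (Set.Iio (4 * K))) (hxw : ∀ i n, x i ≠ w n) (hL : 1 ≤ L) :
    ∀ r ∈ roundsBefore x w L, (Op.merge r.pairs).qubits.Nodup := by
  obtain ⟨r, rs, hr, hrs, hfirst⟩ := exists_roundsBefore x w hL
  have hnodup := nodup_qubits_upLevels hw (L := L)
  have hleaves : (Op.merge (attachLeaves x w).pairs).qubits.Nodup := by
    rw [Op.qubits, attachLeaves, List.flatMap_map]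
    refine List.nodup_flatMap.2 ⟨fun i _ => by simp [hxw], (List.nodup_finRange K).imp
      fun {i j} hij => ?_⟩
    have hwij : w (K + i) ≠ w (K + j) := wire_ne hw (by omega) (by omega) (by omega)
    simp [List.disjoint_left, hx.eq_iff, hij, hxw, (hxw _ _).symm, hwij]
  rw [hr, List.forall_mem_cons] at hnodup
  rw [hrs, List.forall_mem_cons]
  refine ⟨?_, hnodup.2⟩
  have hpar : (Round.par [attachLeaves x w, r]).pairs = (attachLeaves x w).pairs ++ r.pairs := by
    simp [Round.par]
  rw [hpar, Op.qubits, List.flatMap_append]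
  refine List.nodup_append'.2 ⟨hleaves, hnodup.1, fun q hq hq' => ?_⟩
  obtain ⟨p, hp, hq'⟩ := List.mem_flatMap.1 hq'
  obtain ⟨-, j, hj, hfst, hsnd⟩ := hfirst p hp
  rw [hfst, hsnd] at hq'
  rw [attachLeaves, List.flatMap_map] at hq
  obtain ⟨i, -, hq⟩ := List.mem_flatMap.1 hq
  have hc : w (K + i) ≠ w (3 * K + j) := wire_ne hw (by omega) (by omega) (by omega)
  have ht : w (K + i) ≠ w j := wire_ne hw (by omega) (by omega) (by omega)
  simp only [List.mem_cons, List.not_mem_nil, or_false] at hq hq'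
  rcases hq with rfl | rfl <;> rcases hq' with h | h
  · exact hxw _ _ h
  · exact hxw _ _ h
  · exact hc h
  · exact ht h

end Qubits

section Rounds

variable {Q : Type} {K : ℕ} {x : Fin K → Q} {w : ℕ → Q} {L : ℕ}

theorem instant_of_mem_rest_parallel {fs : List (ℕ → Round Q ℕ)} {N : List ℕ}
    (h : ∀ f ∈ fs, ∀ j, ∀ o ∈ (f j).rest, o.Instant) :
    ∀ r ∈ parallel fs N, ∀ o ∈ r.rest, o.Instant := by
  intro r hr o ho
  obtain ⟨f, hf, rfl⟩ := List.mem_map.1 hr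
  obtain ⟨_, hr, ho⟩ := List.mem_flatMap.1 ho
  obtain ⟨j, -, rfl⟩ := List.mem_map.1 hr
  exact h f hf j o ho

theorem instant_of_mem_rest_upLevels : ∀ r ∈ upLevels K w L, ∀ o ∈ r.rest, o.Instant := by
  intro r hr
  obtain ⟨d, -, hr⟩ := List.mem_flatMap.1 hr
  refine instant_of_mem_rest_parallel ?_ r hr
  simp [upRounds, attachTarget, attachSource, Round.par, eraseProduct, eraseCopy, updateFrames,
    erase, Op.Instant, Op.cycles]

theorem instant_of_mem_rest_downLevels : ∀ r ∈ downLevels K w L, ∀ o ∈ r.rest, o.Instant := by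
  intro r hr
  obtain ⟨d, -, hr⟩ := List.mem_flatMap.1 hr
  refine instant_of_mem_rest_parallel ?_ r hr
  simp [downRounds, Round.par, eraseRight, measureLeft, erase, Op.Instant, Op.cycles]

theorem instant_of_mem_rest_roundsBefore (hL : 1 ≤ L) :
    ∀ r ∈ roundsBefore x w L, ∀ o ∈ r.rest, o.Instant := by
  obtain ⟨r, rs, hr, hrs, -⟩ := exists_roundsBefore x w hL
  have h := instant_of_mem_rest_upLevels (K := K) (w := w) (L := L)
  rw [hr, List.forall_mem_cons] at h
  rw [hrs, List.forall_mem_cons]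
  simpa [Round.par, attachLeaves] using h

theorem length_upLevels : (upLevels K w L).length = 3 * L := by
  simp [upLevels, parallel, upRounds, List.length_flatMap, mul_comm]

theorem length_downLevels : (downLevels K w L).length = L := by
  simp [downLevels, parallel, downRounds, List.length_flatMap]

theorem cycles_circuitOps (hL : 1 ≤ L) (nP : ℕ) :
    ((circuitOps x w L).map (Op.cycles nP)).sum = nP + 4 * L := by
  rw [circuitOps, List.map_append, List.map_append, List.sum_append, List.sum_append,
    sum_cycles_flatMap_ops (instant_of_mem_rest_roundsBefore hL),
    sum_cycles_flatMap_ops instant_of_mem_rest_downLevels, roundsBefore, List.length_modifyHead,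
    length_upLevels, length_downLevels]
  simp only [rootOps, Op.cycles, List.map_cons, List.map_nil, List.sum_cons, List.sum_nil]
  omega

theorem nodup_qubits_circuitOps (hx : Function.Injective x) (hw : Set.InjOn w (Set.Iio (4 * K)))
    (hxw : ∀ i n, x i ≠ w n) (hL : 1 ≤ L) :
    ∀ ms, Op.merge ms ∈ circuitOps x w L → (Op.merge ms).qubits.Nodup := by
  intro ms hms
  rcases List.mem_append.1 hms with hms | hms
  · rcases List.mem_append.1 hms with hms | hms
    · obtain ⟨r, hr, rfl⟩ :=
        exists_pairs_eq_of_merge_mem (instant_of_mem_rest_roundsBefore hL) hms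
      exact nodup_qubits_roundsBefore hx hw hxw hL r hr
    · simp [rootOps] at hms
  · obtain ⟨r, hr, rfl⟩ := exists_pairs_eq_of_merge_mem instant_of_mem_rest_downLevels hms
    exact nodup_qubits_downLevels hw r hr

theorem sum_map_flatMap {B : Type} (c : Op Q B → ℕ) {f : ℕ → List (Op Q B)} {k : ℕ}
    (h : ∀ j, ((f j).map c).sum = k) (N : List ℕ) :
    ((N.flatMap f).map c).sum = N.length * k := by
  induction N with
  | nil => simp
  | cons j N ih =>
    rw [List.flatMap_cons, List.map_append, List.sum_append, h, ih, List.length_cons]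
    ring

theorem size_circuitOps_le (hw : Set.InjOn w (Set.Iio (4 * K))) (hK : 1 ≤ K) (hL : 1 ≤ L)
    (hKL : K ≤ 2 ^ L) : ((circuitOps x w L).map Op.size).sum ≤ 27 * K := by
  classical
  have hup (j : ℕ) : ((upNode K w j).map Op.size).sum = 20 := by
    simp [upNode, couple, eraseBoth, attachTarget, attachSource, eraseProduct, eraseCopy,
      updateFrames, erase, Round.ops, Op.size]
  have hdown (j : ℕ) : ((downNode w j).map Op.size).sum = 6 := by
    simp [downNode, eraseRight, measureLeft, erase, Round.ops, Op.size]
  rw [(circuitOps_reorders hw hK hL hKL).size]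
  simp only [circuitProgram, upProgram, downProgram, attachLeaves, rootOps, Round.ops, Op.size,
    List.map_append, List.sum_append, sum_map_flatMap _ hup, sum_map_flatMap _ hdown,
    List.map_cons, List.map_nil, List.sum_cons, List.sum_nil, List.length_map,
    List.length_finRange, List.length_reverse, List.length_range']
  omega

theorem range_of_mem_qubits_parallel {fs : List (ℕ → Round Q ℕ)} {N : List ℕ}
    (h : ∀ j, ∀ o ∈ sequential fs j, ∀ q ∈ o.qubits, q ∈ Set.range w) :
    ∀ o ∈ (parallel fs N).flatMap Round.ops, ∀ q ∈ o.qubits, q ∈ Set.range w := by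
  intro o ho q hq
  obtain ⟨r, hr, ho⟩ := List.mem_flatMap.1 ho
  obtain ⟨f, hf, rfl⟩ := List.mem_map.1 hr
  have hj : ∀ j, ∀ o ∈ (f j).ops, ∀ q ∈ o.qubits, q ∈ Set.range w :=
    fun j o ho => h j o (List.mem_flatMap.2 ⟨f, hf, ho⟩)
  rcases List.mem_cons.1 ho with rfl | ho
  · obtain ⟨p, hp, hq⟩ := List.mem_flatMap.1 hq
    obtain ⟨_, hr, hp⟩ := List.mem_flatMap.1 hp
    obtain ⟨j, -, rfl⟩ := List.mem_map.1 hr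
    exact hj j _ List.mem_cons_self q (List.mem_flatMap.2 ⟨p, hp, hq⟩)
  · obtain ⟨_, hr, ho⟩ := List.mem_flatMap.1 ho
    obtain ⟨j, -, rfl⟩ := List.mem_map.1 hr
    exact hj j o (List.mem_cons_of_mem _ ho) q hq

theorem Op.LocalAt.mem_range {j : ℕ} {o : Op Q ℕ} (h : o.LocalAt K w j) :
    ∀ q ∈ o.qubits, q ∈ Set.range w :=
  fun q hq => Set.image_subset_range _ _ (h.qubits q hq)

theorem exists_circuitOps_eq_merge_cons (x : Fin K → Q) (w : ℕ → Q) (hL : 1 ≤ L) :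
    ∃ ms post, circuitOps x w L = .merge ms :: post ∧
      ∀ o ∈ post, ∀ q ∈ o.qubits, q ∈ Set.range w := by
  obtain ⟨r, rs, hr, hrs, -⟩ := exists_roundsBefore x w hL
  have hup : ∀ o ∈ (upLevels K w L).flatMap Round.ops, ∀ q ∈ o.qubits, q ∈ Set.range w := by
    rw [upLevels, List.flatMap_assoc]
    intro o ho
    obtain ⟨d, -, ho⟩ := List.mem_flatMap.1 ho
    exact range_of_mem_qubits_parallel
      (fun j o ho => (localAt_of_mem_upRounds (K := K) o ho).mem_range) o ho
  have hdown : ∀ o ∈ (downLevels K w L).flatMap Round.ops, ∀ q ∈ o.qubits, q ∈ Set.range w := by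
    rw [downLevels, List.flatMap_assoc]
    intro o ho
    obtain ⟨d, -, ho⟩ := List.mem_flatMap.1 ho
    exact range_of_mem_qubits_parallel
      (fun j o ho => (localAt_of_mem_downRounds (K := K) o ho).mem_range) o ho
  have hroot : ∀ o ∈ rootOps w, ∀ q ∈ o.qubits, q ∈ Set.range w := by
    simp [rootOps, Op.qubits]
  rw [hr, List.flatMap_cons, Round.ops, List.cons_append, List.forall_mem_cons] at hup
  refine ⟨(attachLeaves x w).pairs ++ r.pairs,
    r.rest ++ rs.flatMap Round.ops ++ rootOps w ++ (downLevels K w L).flatMap Round.ops,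
    ?_, fun o ho => ?_⟩
  · rw [circuitOps, hrs]
    simp [Round.ops, Round.par, attachLeaves]
  · rcases List.mem_append.1 ho with ho | ho
    · rcases List.mem_append.1 ho with ho | ho
      exacts [hup.2 o ho, hroot o ho]
    · exact hdown o ho

end Rounds

/-! ### The computation in a branch -/

section NodeValue

variable {K : ℕ}

/-- The value of the node `j` of the tree if the data qubits have the values `y`: that of the data
qubit at a leaf, and the conjunction of the values of its children at an internal node. -/
def nodeValue (y : Fin K → Bool) (j : ℕ) : Bool :=
  if 1 ≤ j ∧ j < K then nodeValue y (2 * j) && nodeValue y (2 * j + 1)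
  else if h : j - K < K then y ⟨j - K, h⟩ else true
termination_by K - j

theorem nodeValue_node (y : Fin K → Bool) {j : ℕ} (hj : 1 ≤ j) (hjK : j < K) :
    nodeValue y j = (nodeValue y (2 * j) && nodeValue y (2 * j + 1)) := by
  rw [nodeValue, if_pos ⟨hj, hjK⟩]

theorem nodeValue_leaf (y : Fin K → Bool) (i : Fin K) : nodeValue y (K + i) = y i := by
  rw [nodeValue, if_neg (by omega), dif_pos (by omega)]
  congr 1
  ext
  simp

theorem nodeValue_true (j : ℕ) : nodeValue (fun _ : Fin K => true) j = true := by
  fun_induction nodeValue (fun _ : Fin K => true) j with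
  | case1 j _ ih₁ ih₂ => simp [ih₁, ih₂]
  | case2 => rfl
  | case3 => rfl

theorem nodeValue_of_root {y : Fin K → Bool} (h : nodeValue y 1 = true) {j : ℕ} (hj : 1 ≤ j)
    (hjK : j < 2 * K) : nodeValue y j = true := by
  induction j using Nat.strong_induction_on with
  | _ j ih =>
    rcases Nat.lt_or_ge j 2 with hj₂ | hj₂
    · rwa [show j = 1 by omega]
    · have hparent := ih (j / 2) (by omega) (by omega) (by omega)
      rw [nodeValue_node y (by omega) (by omega), Bool.and_eq_true] at hparent
      rcases Nat.mod_two_eq_zero_or_one j with hmod | hmod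
      · rw [show j = 2 * (j / 2) by omega]
        exact hparent.1
      · rw [show j = 2 * (j / 2) + 1 by omega]
        exact hparent.2

theorem nodeValue_one (y : Fin K → Bool) : nodeValue y 1 = true ↔ y = fun _ => true := by
  refine ⟨fun h => funext fun i => ?_, fun h => by rw [h, nodeValue_true]⟩
  rw [← nodeValue_leaf y i, nodeValue_of_root h (by omega) (by omega)]

end NodeValue

section Frontier

/-- The product of the weights `f` of the nodes `i ≤ c < 2 * i`, which form a cut of the tree, and
of the weights `g` of the nodes below them. -/
def frontier (K i : ℕ) (f g : ℕ → ℂ) : ℂ :=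
  (∏ c ∈ Finset.Ico i (2 * i), f c) * ∏ c ∈ Finset.Ico (2 * i) (2 * K), g c

/-- The factors that `frontier K i f g` and `frontier K (i + 1) f g` have in common. -/
def frontierCore (K i : ℕ) (f g : ℕ → ℂ) : ℂ :=
  (∏ c ∈ Finset.Ico (i + 1) (2 * i), f c) * ∏ c ∈ Finset.Ico (2 * i + 2) (2 * K), g c

variable {K i : ℕ} (f g : ℕ → ℂ)

theorem frontier_eq (hi : 1 ≤ i) (hiK : i < K) :
    frontier K i f g = f i * (frontierCore K i f g * (g (2 * i) * g (2 * i + 1))) := by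
  rw [frontier, frontierCore, Finset.prod_eq_prod_Ico_succ_bot (show i < 2 * i by omega),
    Finset.prod_eq_prod_Ico_succ_bot (show 2 * i < 2 * K by omega),
    Finset.prod_eq_prod_Ico_succ_bot (show 2 * i + 1 < 2 * K by omega)]
  ring

theorem frontier_succ_eq (hi : 1 ≤ i) :
    frontier K (i + 1) f g = frontierCore K i f g * (f (2 * i) * f (2 * i + 1)) := by
  rw [frontier, frontierCore, mul_add_one,
    Finset.prod_Ico_succ_top (show i + 1 ≤ 2 * i + 1 by omega),
    Finset.prod_Ico_succ_top (show i + 1 ≤ 2 * i by omega)]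
  ring

variable {f g}

theorem frontierCore_congr {f' g' : ℕ → ℂ} (hf : ∀ c, i < c → c < 2 * i → f c = f' c)
    (hg : ∀ c, 2 * i + 2 ≤ c → c < 2 * K → g c = g' c) :
    frontierCore K i f g = frontierCore K i f' g' := by
  refine congrArg₂ (· * ·) (Finset.prod_congr rfl fun c hc => ?_)
    (Finset.prod_congr rfl fun c hc => ?_)
  · exact hf c (Finset.mem_Ico.1 hc).1 (Finset.mem_Ico.1 hc).2
  · exact hg c (Finset.mem_Ico.1 hc).1 (Finset.mem_Ico.1 hc).2

end Frontier

section Invariants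

variable {Q : Type} {K : ℕ} (x : Fin K → Q) (w : ℕ → Q)

/-- The state in which the nodes from `i` on have been computed: those without a computed parent up
to the frames stored in `m`, the other ones exactly. The CCZ states of the nodes before `i` are
intact; `R` is the state of the qubits that are not in use any more. -/
noncomputable def upState (m : ℕ → Bool) (R : State Q) (ψ : State (Fin K)) (i : ℕ) : State Q :=
  fun z => ψ (z ∘ x) * R z *
    frontier K i (fun c => overlap (z (w c)) (xor (nodeValue (z ∘ x) c) (m (bit .frame c))))
      (fun c => overlap (z (w c)) (nodeValue (z ∘ x) c)) *
    ∏ j ∈ Finset.Ico 1 i, nodeAmp K w j z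

/-- The state in which the children of the nodes before `i` have been removed, and the signs stored
in `m` are present. -/
noncomputable def downState (m : ℕ → Bool) (R : State Q) (ψ : State (Fin K)) (i : ℕ) : State Q :=
  fun z => ψ (z ∘ x) * R z *
    frontier K i (fun c => sgn (m (bit .sign c) && nodeValue (z ∘ x) c))
      (fun c => overlap (z (w c)) (nodeValue (z ∘ x) c))

/-- The factors that `upState x w m R ψ i` and `upState x w m R ψ (i + 1)` have in common. -/
noncomputable def upCore (m : ℕ → Bool) (R : State Q) (ψ : State (Fin K)) (i : ℕ) : State Q :=
  fun z => ψ (z ∘ x) * R z *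
    frontierCore K i (fun c => overlap (z (w c)) (xor (nodeValue (z ∘ x) c) (m (bit .frame c))))
      (fun c => overlap (z (w c)) (nodeValue (z ∘ x) c)) *
    ∏ j ∈ Finset.Ico 1 i, nodeAmp K w j z

/-- The factors that `downState x w m R ψ i` and `downState x w m R ψ (i + 1)` have in common. -/
noncomputable def downCore (m : ℕ → Bool) (R : State Q) (ψ : State (Fin K)) (i : ℕ) : State Q :=
  fun z => ψ (z ∘ x) * R z *
    frontierCore K i (fun c => sgn (m (bit .sign c) && nodeValue (z ∘ x) c))
      (fun c => overlap (z (w c)) (nodeValue (z ∘ x) c))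

/-- The qubits that are still in use when the nodes from `i` on have been computed. -/
def upLive (i : ℕ) : Set Q :=
  Set.range x ∪
    w '' {n | 1 ≤ n ∧ n < 2 * K ∨ 2 * K < n ∧ n < 2 * K + i ∨ 3 * K < n ∧ n < 3 * K + i}

/-- The qubits that are still in use when the children of the nodes before `i` have been
removed. -/
def downLive (i : ℕ) : Set Q := Set.range x ∪ w '' {n | 2 * i ≤ n ∧ n < 2 * K}

theorem monotone_upLive : Monotone (upLive x w) := fun i j hij =>
  Set.union_subset_union_right _ <| Set.image_mono fun n hn => by
    rw [Set.mem_ofPred_eq] at hn ⊢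
    omega

theorem antitone_downLive : Antitone (downLive x w) := fun i j hij =>
  Set.union_subset_union_right _ <| Set.image_mono fun n hn => by
    rw [Set.mem_ofPred_eq] at hn ⊢
    omega

end Invariants

section UpStep

variable {Q : Type} {K : ℕ} {x : Fin K → Q} {w : ℕ → Q} {i : ℕ}

theorem upState_succ_eq (m : ℕ → Bool) (R : State Q) (ψ : State (Fin K)) (hi : 1 ≤ i) :
    upState x w m R ψ (i + 1) = fun z => upCore x w m R ψ i z *
      (overlap (z (w (2 * i))) (xor (nodeValue (z ∘ x) (2 * i)) (m (bit .frame (2 * i)))) *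
        overlap (z (w (2 * i + 1)))
          (xor (nodeValue (z ∘ x) (2 * i + 1)) (m (bit .frame (2 * i + 1))))) *
      nodeAmp K w i z := by
  funext z
  rw [upState, upCore, frontier_succ_eq _ _ hi, Finset.prod_Ico_succ_top hi]
  ring

theorem upState_eq (m : ℕ → Bool) (R : State Q) (ψ : State (Fin K)) (hi : 1 ≤ i) (hiK : i < K) :
    upState x w m R ψ i = fun z => upCore x w m R ψ i z *
      (overlap (z (w (2 * i))) (nodeValue (z ∘ x) (2 * i)) *
        overlap (z (w (2 * i + 1))) (nodeValue (z ∘ x) (2 * i + 1))) *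
      overlap (z (w i))
        (xor (nodeValue (z ∘ x) (2 * i) && nodeValue (z ∘ x) (2 * i + 1)) (m (bit .frame i))) := by
  funext z
  rw [upState, upCore, frontier_eq _ _ hi hiK, nodeValue_node _ hi hiK]
  ring

theorem execMemory_upNode_frame_of_ne (ω m : ℕ → Bool) {c : ℕ} (hc : c ≠ i) :
    execMemory ω (upNode K w i) m (bit .frame c) = m (bit .frame c) := by
  refine execMemory_of_notMem_writes _ _ _ ?_
  rw [writes_upNode]
  simp [upBits, hc]

theorem upCore_execMemory_upNode (ω m : ℕ → Bool) (R : State Q) (ψ : State (Fin K)) :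
    upCore x w (execMemory ω (upNode K w i) m) R ψ i = upCore x w m R ψ i := by
  funext z
  rw [upCore, upCore, frontierCore_congr (fun c hc _ => ?_) fun _ _ _ => rfl]
  rw [execMemory_upNode_frame_of_ne ω m hc.ne']

theorem notMem_nodeQubits (hw : Set.InjOn w (Set.Iio (4 * K))) (hiK : i < K) {n : ℕ}
    (hn : n < 4 * K) (h : n ≠ 2 * i ∧ n ≠ 2 * i + 1 ∧ n ≠ 2 * K + i ∧ n ≠ 3 * K + i) :
    w n ∉ nodeQubits K w i := by
  have hne {n' : ℕ} (hn' : n' < 4 * K) (h : n ≠ n') : w n ≠ w n' := wire_ne hw hn hn' h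
  simp only [nodeQubits, Set.mem_insert_iff, Set.mem_singleton_iff, not_or]
  exact ⟨hne (by omega) h.1, hne (by omega) h.2.1, hne (by omega) h.2.2.1, hne (by omega) h.2.2.2⟩

theorem comp_eq_comp_of_eqOn_nodeQubits_compl (hxw : ∀ i n, x i ≠ w n) {z z' : Q → Bool}
    (h : ∀ q ∈ (nodeQubits K w i)ᶜ, z q = z' q) : z ∘ x = z' ∘ x :=
  funext fun k => h _ (by simp [nodeQubits, hxw])

theorem dependsOn_nodeValue (hxw : ∀ i n, x i ≠ w n) (c : ℕ) :
    DependsOn (fun z : Q → Bool => nodeValue (z ∘ x) c) (nodeQubits K w i)ᶜ := fun z z' h => by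
  dsimp only
  rw [comp_eq_comp_of_eqOn_nodeQubits_compl hxw h]

theorem nodeQubits_subset_upLive (hi : 1 ≤ i) (hiK : i < K) :
    nodeQubits K w i ⊆ upLive x w (i + 1) := by
  have hw {n : ℕ} (hn : 1 ≤ n ∧ n < 2 * K ∨ 2 * K < n ∧ n < 2 * K + (i + 1) ∨
      3 * K < n ∧ n < 3 * K + (i + 1)) : w n ∈ upLive x w (i + 1) := Or.inr ⟨n, hn, rfl⟩
  rintro _ (rfl | rfl | rfl | rfl) <;> exact hw (by omega)

theorem notMem_upLive (hw : Set.InjOn w (Set.Iio (4 * K))) (hxw : ∀ i n, x i ≠ w n) (hiK : i ≤ K)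
    {n : ℕ} (hn : 2 * K + i ≤ n ∧ n < 3 * K ∨ 3 * K + i ≤ n ∧ n < 4 * K) :
    w n ∉ upLive x w i := by
  rintro (⟨k, hk⟩ | ⟨n', hn', hne⟩)
  · exact hxw k n hk
  · rw [Set.mem_ofPred_eq] at hn'
    exact wire_ne hw (by omega) (by omega) (by omega) hne

theorem dependsOn_upCore (hw : Set.InjOn w (Set.Iio (4 * K))) (hxw : ∀ i n, x i ≠ w n)
    (hi : 1 ≤ i) (hiK : i < K) (m : ℕ → Bool) {R : State Q}
    (hR : DependsOn R (upLive x w (i + 1))ᶜ) (ψ : State (Fin K)) :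
    DependsOn (upCore x w m R ψ i) (nodeQubits K w i)ᶜ := fun z z' h => by
  have hz {n : ℕ} (hn : n < 4 * K)
      (hni : n ≠ 2 * i ∧ n ≠ 2 * i + 1 ∧ n ≠ 2 * K + i ∧ n ≠ 3 * K + i) : z (w n) = z' (w n) :=
    h _ (notMem_nodeQubits hw hiK hn hni)
  rw [upCore, upCore, comp_eq_comp_of_eqOn_nodeQubits_compl hxw h,
    hR fun q hq => h q fun hq' => hq (nodeQubits_subset_upLive hi hiK hq')]
  congr 1
  · refine congrArg _ (frontierCore_congr (fun c _ _ => ?_) fun c _ _ => ?_) <;>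
      rw [hz (by omega) (by omega)]
  · refine Finset.prod_congr rfl fun j hj => ?_
    have hj := Finset.mem_Ico.1 hj
    rw [nodeAmp, nodeAmp, hz (n := 3 * K + j) (by omega) (by omega),
      hz (n := 2 * K + j) (by omega) (by omega), hz (n := 2 * j) (by omega) (by omega),
      hz (n := 2 * j + 1) (by omega) (by omega)]

variable [DecidableEq Q]

theorem exists_execState_upNode_upState (γ : ℝ) (ω : ℕ → Bool) {m : ℕ → Bool}
    (hw : Set.InjOn w (Set.Iio (4 * K))) (hxw : ∀ i n, x i ≠ w n) (hi : 1 ≤ i) (hiK : i < K)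
    (hm : Fresh m (upNode K w i)) {R : State Q} (hR : DependsOn R (upLive x w (i + 1))ᶜ) :
    ∃ R' : State Q, DependsOn R' (upLive x w i)ᶜ ∧ ∀ ψ : State (Fin K),
      execState γ ω (upNode K w i) m (upState x w m R ψ (i + 1)) =
        upState x w (execMemory ω (upNode K w i) m) R' ψ i := by
  obtain ⟨χ, h⟩ := exists_execState_upNode γ ω hw hi hiK hm
  refine ⟨fun z => χ (z (w (2 * K + i))) (z (w (3 * K + i))) * R z, fun z z' hz => ?_, fun ψ => ?_⟩
  · dsimp only
    rw [hz (w (2 * K + i)) (notMem_upLive hw hxw hiK.le (by omega)),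
      hz (w (3 * K + i)) (notMem_upLive hw hxw hiK.le (by omega)),
      hR fun q hq => hz q fun hq' => hq (monotone_upLive x w i.le_succ hq')]
  · rw [upState_succ_eq m R ψ hi, h (dependsOn_upCore hw hxw hi hiK m hR ψ)
      (dependsOn_nodeValue hxw _) (dependsOn_nodeValue hxw _), upState_eq _ _ ψ hi hiK,
      upCore_execMemory_upNode]
    funext z
    simp only [upCore]
    ring

end UpStep

section DownStep

variable {Q : Type} {K : ℕ} {x : Fin K → Q} {w : ℕ → Q} {i : ℕ}

theorem downState_eq (m : ℕ → Bool) (R : State Q) (ψ : State (Fin K)) (hi : 1 ≤ i) (hiK : i < K) :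
    downState x w m R ψ i = fun z => downCore x w m R ψ i z *
      sgn (m (bit .sign i) && (nodeValue (z ∘ x) (2 * i) && nodeValue (z ∘ x) (2 * i + 1))) *
      (overlap (z (w (2 * i))) (nodeValue (z ∘ x) (2 * i)) *
        overlap (z (w (2 * i + 1))) (nodeValue (z ∘ x) (2 * i + 1))) := by
  funext z
  rw [downState, downCore, frontier_eq _ _ hi hiK, nodeValue_node _ hi hiK]
  ring

theorem downState_succ_eq (m : ℕ → Bool) (R : State Q) (ψ : State (Fin K)) (hi : 1 ≤ i) :
    downState x w m R ψ (i + 1) = fun z => downCore x w m R ψ i z *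
      (sgn (m (bit .sign (2 * i)) && nodeValue (z ∘ x) (2 * i)) *
        sgn (m (bit .sign (2 * i + 1)) && nodeValue (z ∘ x) (2 * i + 1))) := by
  funext z
  rw [downState, downCore, frontier_succ_eq _ _ hi]
  ring

theorem execMemory_downNode_sign_of_ne (ω m : ℕ → Bool) {c : ℕ} (hc : c ≠ 2 * i)
    (hc' : c ≠ 2 * i + 1) : execMemory ω (downNode w i) m (bit .sign c) = m (bit .sign c) := by
  refine execMemory_of_notMem_writes _ _ _ ?_
  rw [writes_downNode]
  simp [downBits, hc, hc']

theorem downCore_execMemory_downNode (ω m : ℕ → Bool) (R : State Q) (ψ : State (Fin K)) :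
    downCore x w (execMemory ω (downNode w i) m) R ψ i = downCore x w m R ψ i := by
  funext z
  rw [downCore, downCore, frontierCore_congr (fun c _ hc => ?_) fun _ _ _ => rfl]
  rw [execMemory_downNode_sign_of_ne ω m (by omega) (by omega)]

theorem notMem_downLive (hw : Set.InjOn w (Set.Iio (4 * K))) (hxw : ∀ i n, x i ≠ w n) {n : ℕ}
    (hni : n < 2 * i) (hn : n < 4 * K) : w n ∉ downLive x w i := by
  rintro (⟨k, hk⟩ | ⟨n', hn', hne⟩)
  · exact hxw k n hk
  · rw [Set.mem_ofPred_eq] at hn'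
    exact wire_ne hw (by omega) hn (by omega) hne

theorem dependsOn_downCore (hw : Set.InjOn w (Set.Iio (4 * K))) (hxw : ∀ i n, x i ≠ w n)
    (hiK : i < K) (m : ℕ → Bool) {R : State Q} (hR : DependsOn R (downLive x w i)ᶜ)
    (ψ : State (Fin K)) :
    DependsOn (downCore x w m R ψ i) {w (2 * i), w (2 * i + 1)}ᶜ := fun z z' h => by
  have hz {n : ℕ} (hn : n < 4 * K) (hni : n ≠ 2 * i ∧ n ≠ 2 * i + 1) : z (w n) = z' (w n) :=
    h _ (by simp [wire_ne hw hn (show 2 * i < 4 * K by omega) hni.1,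
      wire_ne hw hn (show 2 * i + 1 < 4 * K by omega) hni.2])
  have hx : z ∘ x = z' ∘ x := funext fun k => h _ (by simp [hxw])
  have hRz : R z = R z' := hR fun q hq => h q <| by
    rintro (rfl | rfl)
    · exact hq (Or.inr ⟨_, by rw [Set.mem_ofPred_eq]; omega, rfl⟩)
    · exact hq (Or.inr ⟨_, by rw [Set.mem_ofPred_eq]; omega, rfl⟩)
  rw [downCore, downCore, hx, hRz]
  congr 1
  refine frontierCore_congr (fun c _ _ => rfl) fun c _ _ => ?_
  rw [hz (by omega) (by omega)]

variable [DecidableEq Q]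

theorem exists_execState_downNode_downState (γ : ℝ) (ω : ℕ → Bool) {m : ℕ → Bool}
    (hw : Set.InjOn w (Set.Iio (4 * K))) (hxw : ∀ i n, x i ≠ w n) (hi : 1 ≤ i) (hiK : i < K)
    (hm : Fresh m (downNode w i)) {R : State Q} (hR : DependsOn R (downLive x w i)ᶜ) :
    ∃ R' : State Q, DependsOn R' (downLive x w (i + 1))ᶜ ∧ ∀ ψ : State (Fin K),
      execState γ ω (downNode w i) m (downState x w m R ψ i) =
        downState x w (execMemory ω (downNode w i) m) R' ψ (i + 1) := by
  have hx (c : ℕ) : DependsOn (fun z : Q → Bool => nodeValue (z ∘ x) c)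
      {w (2 * i), w (2 * i + 1)}ᶜ := fun z z' h => by
    dsimp only
    rw [show z ∘ x = z' ∘ x from funext fun k => h _ (by simp [hxw])]
  obtain ⟨χ, h⟩ := exists_execState_downNode γ ω
    (wire_ne hw (i := 2 * i) (by omega) (by omega) (by omega)) hm
  refine ⟨fun z => χ (z (w (2 * i))) (z (w (2 * i + 1))) * R z, fun z z' hz => ?_, fun ψ => ?_⟩
  · dsimp only
    rw [hz (w (2 * i)) (notMem_downLive hw hxw (by omega) (by omega)),
      hz (w (2 * i + 1)) (notMem_downLive hw hxw (by omega) (by omega)),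
      hR fun q hq => hz q fun hq' => hq (antitone_downLive x w i.le_succ hq')]
  · rw [downState_eq m R ψ hi hiK, h (dependsOn_downCore hw hxw hiK m hR ψ) (hx _) (hx _),
      downState_succ_eq _ _ ψ hi, downCore_execMemory_downNode]
    funext z
    simp only [downCore]
    ring

end DownStep

section Runs

variable {Q : Type} {K : ℕ} {x : Fin K → Q} {w : ℕ → Q} {i : ℕ}

theorem upProgram_self (K : ℕ) (w : ℕ → Q) : upProgram K w K = [] := by simp [upProgram]

theorem upProgram_eq_append (w : ℕ → Q) (hiK : i < K) :
    upProgram K w i = upProgram K w (i + 1) ++ upNode K w i := by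
  rw [upProgram, upProgram, show K - i = K - (i + 1) + 1 by omega, List.range'_succ,
    List.reverse_cons, List.flatMap_append, List.flatMap_singleton]

theorem downProgram_one (w : ℕ → Q) : downProgram w 1 = [] := by simp [downProgram]

theorem downProgram_succ (w : ℕ → Q) (hi : 1 ≤ i) :
    downProgram w (i + 1) = downProgram w i ++ downNode w i := by
  rw [downProgram, downProgram, show i + 1 - 1 = i - 1 + 1 by omega, List.range'_1_concat,
    List.flatMap_append, List.flatMap_singleton, Nat.add_sub_cancel' hi]

variable [DecidableEq Q]

theorem exists_execState_upProgram (γ : ℝ) (ω : ℕ → Bool) {m : ℕ → Bool}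
    (hw : Set.InjOn w (Set.Iio (4 * K))) (hxw : ∀ i n, x i ≠ w n) (hi : 1 ≤ i) (hiK : i ≤ K)
    (hm : Fresh m (upProgram K w i)) (hwr : ((upProgram K w i).flatMap Op.writes).Nodup)
    {R : State Q} (hR : DependsOn R (upLive x w K)ᶜ) :
    ∃ R' : State Q, DependsOn R' (upLive x w i)ᶜ ∧ ∀ ψ : State (Fin K),
      execState γ ω (upProgram K w i) m (upState x w m R ψ K) =
        upState x w (execMemory ω (upProgram K w i) m) R' ψ i := by
  induction hiK using Nat.decreasingInduction with
  | self => exact ⟨R, hR, fun ψ => by rw [upProgram_self]; rfl⟩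
  | of_succ i hiK ih =>
    rw [upProgram_eq_append w hiK] at hm hwr
    obtain ⟨R', hR', h'⟩ := ih (by omega) hm.of_append_left
      (nodup_writes_of_append hwr).1
    obtain ⟨R'', hR'', h''⟩ :=
      exists_execState_upNode_upState γ ω hw hxw hi hiK (hm.execMemory hwr ω) hR'
    refine ⟨R'', hR'', fun ψ => ?_⟩
    rw [upProgram_eq_append w hiK, execState_append, Module.End.mul_apply, h', h'',
      execMemory_append]

theorem exists_execState_downProgram (γ : ℝ) (ω : ℕ → Bool) {m : ℕ → Bool}
    (hw : Set.InjOn w (Set.Iio (4 * K))) (hxw : ∀ i n, x i ≠ w n) (hi : 1 ≤ i) (hiK : i ≤ K)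
    (hm : Fresh m (downProgram w i)) (hwr : ((downProgram w i).flatMap Op.writes).Nodup)
    {R : State Q} (hR : DependsOn R (downLive x w 1)ᶜ) :
    ∃ R' : State Q, DependsOn R' (downLive x w i)ᶜ ∧ ∀ ψ : State (Fin K),
      execState γ ω (downProgram w i) m (downState x w m R ψ 1) =
        downState x w (execMemory ω (downProgram w i) m) R' ψ i := by
  induction i, hi using Nat.le_induction with
  | base => exact ⟨R, hR, fun ψ => by rw [downProgram_one]; rfl⟩
  | succ i hi ih =>
    rw [downProgram_succ w hi] at hm hwr
    obtain ⟨R', hR', h'⟩ := ih (by omega) hm.of_append_left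
      (nodup_writes_of_append hwr).1
    obtain ⟨R'', hR'', h''⟩ :=
      exists_execState_downNode_downState γ ω hw hxw hi (by omega) (hm.execMemory hwr ω) hR'
    refine ⟨R'', hR'', fun ψ => ?_⟩
    rw [downProgram_succ w hi, execState_append, Module.End.mul_apply, h', h'', execMemory_append]

end Runs

section Ends

variable {Q : Type} {K : ℕ} {x : Fin K → Q} {w : ℕ → Q}

theorem phaseGate_mulVec_apply (γ : ℝ) (ψ : State (Fin K)) (y : Fin K → Bool) :
    (phaseGate K γ).mulVec ψ y =
      (if nodeValue y 1 then Complex.exp (Complex.I * γ) else 1) * ψ y := by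
  rw [phaseGate_eq_diagonal, Matrix.mulVec_diagonal]
  simp only [nodeValue_one]

theorem frontier_self (K : ℕ) (f g : ℕ → ℂ) : frontier K K f g = ∏ i : Fin K, f (K + i) := by
  rw [frontier, Finset.Ico_self, Finset.prod_empty, mul_one, Finset.prod_Ico_eq_prod_range,
    show 2 * K - K = K by omega, Finset.prod_range]

theorem overlap_xor_left (a b c : Bool) : overlap (xor a b) c = overlap b (xor a c) := by
  cases a <;> cases b <;> cases c <;> rfl

theorem upState_one (m : ℕ → Bool) (R : State Q) (ψ : State (Fin K)) :
    upState x w m R ψ 1 = fun z => ψ (z ∘ x) * R z *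
      (∏ c ∈ Finset.Ico 2 (2 * K), overlap (z (w c)) (nodeValue (z ∘ x) c)) *
      overlap (z (w 1)) (xor (nodeValue (z ∘ x) 1) (m (bit .frame 1))) := by
  funext z
  simp only [upState, frontier, mul_one, Nat.Ico_succ_singleton, Finset.prod_singleton,
    Finset.Ico_self, Finset.prod_empty]
  ring

theorem downState_one (m : ℕ → Bool) (R : State Q) (ψ : State (Fin K)) :
    downState x w m R ψ 1 = fun z => ψ (z ∘ x) * R z *
      (∏ c ∈ Finset.Ico 2 (2 * K), overlap (z (w c)) (nodeValue (z ∘ x) c)) *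
      sgn (m (bit .sign 1) && nodeValue (z ∘ x) 1) := by
  funext z
  simp only [downState, frontier, mul_one, Nat.Ico_succ_singleton, Finset.prod_singleton]
  ring

variable [DecidableEq Q]

theorem execState_rootOps (γ : ℝ) (ω m : ℕ → Bool) (hw : Set.InjOn w (Set.Iio (4 * K)))
    (hxw : ∀ i n, x i ≠ w n) (hK : 1 ≤ K) {R : State Q} (hR : DependsOn R (upLive x w 1)ᶜ)
    (ψ : State (Fin K)) :
    execState γ ω (rootOps w) m (upState x w m R ψ 1) =
      downState x w (execMemory ω (rootOps w) m)
        (fun z => sgn (z (w 1) && ω (bit .sign 1)) / 2 * R z) ((phaseGate K γ).mulVec ψ) 1 := by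
  have hx (z : Q → Bool) (v : Bool) : Function.update z (w 1) v ∘ x = z ∘ x :=
    funext fun i => Function.update_of_ne (hxw i 1) _ _
  have hRv (z : Q → Bool) (v : Bool) : R (Function.update z (w 1) v) = R z :=
    update_of_dependsOn hR (Or.inr ⟨1, by rw [Set.mem_ofPred_eq]; omega, rfl⟩) z v
  have hprod (z : Q → Bool) (v : Bool) (f : ℕ → Bool) :
      ∏ c ∈ Finset.Ico 2 (2 * K), overlap (Function.update z (w 1) v (w c)) (f c) =
        ∏ c ∈ Finset.Ico 2 (2 * K), overlap (z (w c)) (f c) := Finset.prod_congr rfl fun c hc => by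
    have hc := Finset.mem_Ico.1 hc
    rw [Function.update_of_ne (wire_ne hw (by omega) (by omega) (by omega))]
  have hmem : execMemory ω (rootOps w) m (bit .sign 1) = ω (bit .sign 1) := by
    simp [rootOps, execMemory, Op.memory]
  rw [upState_one, downState_one, hmem]
  simp only [rootOps, execState, Op.effect, one_mul, Module.End.mul_apply]
  funext z
  rw [projOp_X_apply]
  simp only [phaseOp_apply, phaseAct, ite_X_apply, Fintype.sum_bool,
    Function.update_self, Function.update_idem, hx, hRv, phaseGate_mulVec_apply,
    hprod]
  cases nodeValue (z ∘ x) 1 <;> cases m (bit .frame 1) <;> cases ω (bit .sign 1) <;>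
    cases z (w 1) <;> simp <;> ring

theorem prod_reverse_effect_ZZ_apply {ι : Type*} (ω m : ℕ → Bool) (l : List ι) (q o : ι → Q)
    (c b : ι → ℕ) (Φ : State Q) (z : Q → Bool) :
    ((l.map fun i => (⟨q i, o i, fun _ => some (.Z, .Z), c i, b i⟩ : PairMeas Q ℕ)).map
      (PairMeas.effect ω m)).reverse.prod Φ z =
      (l.map fun i => overlap (xor (z (q i)) (z (o i))) (ω (b i))).prod * Φ z := by
  induction l generalizing Φ with
  | nil => simp
  | cons i l ih =>
    simp only [List.map_cons, List.reverse_cons, List.prod_append, List.prod_nil,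
      mul_one, Module.End.mul_apply, ih, PairMeas.effect, projOp_Z_mul_Z_apply, List.prod_cons]
    ring

theorem execState_attachLeaves (γ : ℝ) (ω m : ℕ → Bool) (R : State Q) (ψ : State (Fin K)) :
    execState γ ω (attachLeaves x w).ops m
        (fun z => ψ (z ∘ x) * R z * ∏ j ∈ Finset.Ico 1 K, nodeAmp K w j z) =
      upState x w (execMemory ω (attachLeaves x w).ops m) R ψ K := by
  have hmem (i : Fin K) :
      execMemory ω (attachLeaves x w).ops m (bit .frame (K + i)) = ω (bit .frame (K + i)) := by
    refine (foldl_record_apply ..).trans (if_pos ⟨_, List.mem_map_of_mem (List.mem_finRange i), ?_⟩)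
    simp
  funext z
  rw [upState, frontier_self]
  simp only [nodeValue_leaf, hmem]
  rw [attachLeaves, Round.ops, execState_singleton, Op.effect, prod_reverse_effect_ZZ_apply,
    ← Fin.prod_univ_def]
  simp only [overlap_xor_left, Function.comp_apply]
  ring

theorem exists_execState_circuitProgram (γ : ℝ) (ω : ℕ → Bool)
    (hw : Set.InjOn w (Set.Iio (4 * K))) (hxw : ∀ i n, x i ≠ w n) (hK : 1 ≤ K) {R : State Q}
    (hR : DependsOn R (upLive x w K)ᶜ) :
    ∃ R' : State Q, DependsOn R' (Set.range x)ᶜ ∧ ∀ ψ : State (Fin K),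
      execState γ ω (circuitProgram x w) (fun _ => false)
          (fun z => ψ (z ∘ x) * R z * ∏ j ∈ Finset.Ico 1 K, nodeAmp K w j z) = fun z =>
        (phaseGate K γ).mulVec ψ (z ∘ x) * R' z * ∏ i : Fin K,
          sgn (execMemory ω (circuitProgram x w) (fun _ => false) (bit .sign (K + i)) &&
            z (x i)) := by
  have hwr := nodup_writes_circuitProgram x w
  have hwr_up := (nodup_writes_of_append (nodup_writes_of_append hwr).1).1
  have hfresh (l : List (Op Q ℕ)) : Fresh (fun _ => false) l := fun _ _ => rfl
  obtain ⟨R₁, hR₁, h₁⟩ := exists_execState_upProgram γ ω hw hxw le_rfl hK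
    ((hfresh _).execMemory hwr_up ω) (nodup_writes_of_append hwr_up).2 hR
  have hR₂ : DependsOn (fun z => sgn (z (w 1) && ω (bit .sign 1)) / 2 * R₁ z)
      (downLive x w 1)ᶜ := fun z z' h => by
    have hsub : downLive x w 1 ⊆ upLive x w 1 :=
      Set.union_subset_union_right _ <| Set.image_mono fun n hn => by
        rw [Set.mem_ofPred_eq] at hn ⊢
        omega
    dsimp only
    rw [h _ (notMem_downLive hw hxw (by omega) (by omega)),
      hR₁ fun q hq => h q fun hq' => hq (hsub hq')]
  obtain ⟨R', hR', h'⟩ := exists_execState_downProgram γ ω hw hxw hK le_rfl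
    ((hfresh _).execMemory hwr ω) (nodup_writes_of_append hwr).2 hR₂
  refine ⟨R', hR'.mono (Set.compl_subset_compl.2 Set.subset_union_left), fun ψ => ?_⟩
  rw [circuitProgram, execState_append, execState_append, execState_append,
    Module.End.mul_apply, Module.End.mul_apply, Module.End.mul_apply, execState_attachLeaves, h₁,
    ← execMemory_append ω _ (upProgram K w 1), execState_rootOps γ ω _ hw hxw hK hR₁,
    ← execMemory_append ω _ (rootOps w), h', ← execMemory_append]
  funext z
  rw [downState, frontier_self]
  simp only [nodeValue_leaf, Function.comp_apply]

end Ends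

/-! ### The circuit -/

section Assembly

theorem sgn_mul_self (b : Bool) : sgn b * sgn b = 1 := by
  cases b <;> simp

variable {K A : ℕ} {anc : ℕ → Fin A}

/-- The numbers of the ancillas that hold the CCZ state of the node `i + 1`. -/
def cczIndex (K i : ℕ) : Fin 3 → ℕ := ![2 * (i + 1), 2 * (i + 1) + 1, 2 * K + (i + 1)]

theorem cczIndex_lt {i : ℕ} (hi : i < K - 1) (k : Fin 3) : cczIndex K i k < 3 * K := by
  fin_cases k <;> simp only [cczIndex, Fin.reduceFinMk, Matrix.cons_val] <;> omega

theorem cczIndex_inj {i i' : ℕ} (hi : i < K - 1) (hi' : i' < K - 1) {k k' : Fin 3} :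
    cczIndex K i k = cczIndex K i' k' ↔ i = i' ∧ k = k' := by
  refine ⟨fun h => ?_, fun ⟨h, h'⟩ => h ▸ h' ▸ rfl⟩
  fin_cases k <;> fin_cases k' <;> simp [cczIndex] at h ⊢ <;> omega

theorem exists_cczIndex_eq {n : ℕ} (hn : 2 ≤ n ∧ n < 2 * K ∨ 2 * K < n ∧ n < 3 * K) :
    ∃ i < K - 1, ∃ k, cczIndex K i k = n := by
  rcases hn with hn | hn
  · obtain ⟨j, rfl | rfl⟩ := Nat.even_or_odd' n
    · exact ⟨j - 1, by omega, 0, by simp [cczIndex]; omega⟩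
    · exact ⟨j - 1, by omega, 1, by simp [cczIndex]; omega⟩
  · exact ⟨n - 2 * K - 1, by omega, 2, by simp [cczIndex]; omega⟩

/-- The ancillas that hold the CCZ states of the internal nodes. -/
def nodeCCZ (hanc : Set.InjOn anc (Set.Iio (4 * K))) : Fin (K - 1) × Fin 3 ↪ Fin A where
  toFun p := anc (cczIndex K p.1 p.2)
  inj' p p' h := by
    have hp := cczIndex_lt p.1.2 p.2
    have hp' := cczIndex_lt p'.1.2 p'.2
    obtain ⟨h₁, h₂⟩ := (cczIndex_inj p.1.2 p'.1.2).1
      (hanc (Set.mem_Iio.2 (by omega)) (Set.mem_Iio.2 (by omega)) h)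
    exact Prod.ext (Fin.ext h₁) h₂

/-- The ancillas, initially in the state `|0⟩`, that become copies of the third qubits of the CCZ
states. -/
def copies (K : ℕ) (anc : ℕ → Fin A) : Finset (Fin A) :=
  (Finset.Ico 1 K).image fun j => anc (3 * K + j)

/-- The amplitude of an ancilla `a` outside the CCZ states, where `a₁` starts in `|+⟩` and all
others in `|0⟩`. -/
noncomputable def spareAmp (a₁ a : Fin A) (y : Fin A → Bool) : ℂ :=
  if a ∈ ({a₁} : Finset (Fin A)) then 1 / (Real.sqrt 2 : ℂ) else if y a then 0 else 1

variable (hanc : Set.InjOn anc (Set.Iio (4 * K)))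

theorem mem_map_nodeCCZ {a : Fin A} :
    a ∈ Finset.univ.map (nodeCCZ hanc) ↔ ∃ i < K - 1, ∃ k, anc (cczIndex K i k) = a := by
  simp only [Finset.mem_map, Finset.mem_univ, true_and, Prod.exists]
  exact Fin.exists_iff.trans
    (exists_congr fun i => exists_prop (b := ∃ k, anc (cczIndex K i k) = a))

include hanc in
theorem injOn_copies :
    Set.InjOn (fun j => anc (3 * K + j)) (Finset.Ico 1 K) := fun i hi j hj h => by
  rw [Finset.mem_coe, Finset.mem_Ico] at hi hj
  have := hanc (Set.mem_Iio.2 (by omega)) (Set.mem_Iio.2 (by omega)) h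
  omega

theorem copies_subset_compl_map_nodeCCZ :
    copies K anc ⊆ (Finset.univ.map (nodeCCZ hanc))ᶜ := by
  intro a ha
  obtain ⟨j, hj, rfl⟩ := Finset.mem_image.1 ha
  rw [Finset.mem_Ico] at hj
  rw [Finset.mem_compl, mem_map_nodeCCZ]
  rintro ⟨i, hi, k, h⟩
  have hlt := cczIndex_lt hi k
  have := hanc (Set.mem_Iio.2 (by omega)) (Set.mem_Iio.2 (by omega)) h
  omega

theorem prod_cczAmp_nodeCCZ (y : Fin A → Bool) :
    ∏ i, cczAmp (y (nodeCCZ hanc (i, 0))) (y (nodeCCZ hanc (i, 1))) (y (nodeCCZ hanc (i, 2))) =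
      (1 / (Real.sqrt 8 : ℂ)) ^ (K - 1) * ∏ j ∈ Finset.Ico 1 K,
        sgn (y (anc (2 * K + j)) && (y (anc (2 * j)) && y (anc (2 * j + 1)))) := by
  have hccz (i : Fin (K - 1)) : cczAmp (y (nodeCCZ hanc (i, 0))) (y (nodeCCZ hanc (i, 1)))
      (y (nodeCCZ hanc (i, 2))) =
      1 / (Real.sqrt 8 : ℂ) * sgn (y (anc (2 * K + (1 + i))) &&
        (y (anc (2 * (1 + i))) && y (anc (2 * (1 + i) + 1)))) := by
    rw [add_comm 1, Bool.and_comm (y (anc (2 * K + _))), one_div_mul_eq_div]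
    rfl
  rw [Finset.prod_congr rfl fun i _ => hccz i, Finset.prod_mul_distrib, Finset.prod_const,
    Finset.card_fin, Finset.prod_Ico_eq_prod_range,
    ← Fin.prod_univ_eq_prod_range (fun i => sgn (y (anc (2 * K + (1 + i))) &&
      (y (anc (2 * (1 + i))) && y (anc (2 * (1 + i) + 1)))))]

include hanc in
theorem prod_copies_spareAmp (y : Fin A → Bool) :
    ∏ a ∈ copies K anc, spareAmp (anc 1) a y =
      ∏ j ∈ Finset.Ico 1 K, overlap (y (anc (3 * K + j))) false := by
  rw [copies, Finset.prod_image (injOn_copies hanc)]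
  refine Finset.prod_congr rfl fun j hj => ?_
  rw [Finset.mem_Ico] at hj
  have hne : anc (3 * K + j) ∉ ({anc 1} : Finset (Fin A)) := fun h => by
    have := hanc (Set.mem_Iio.2 (by omega)) (Set.mem_Iio.2 (by omega)) (Finset.mem_singleton.1 h)
    omega
  rw [spareAmp, if_neg hne, overlap]
  cases y (anc (3 * K + j)) <;> rfl

theorem inr_notMem_upLive {a : Fin A} (h₁ : a ≠ anc 1) (hccz : a ∉ Finset.univ.map (nodeCCZ hanc))
    (hcopies : a ∉ copies K anc) :
    Sum.inr a ∉ upLive (Sum.inl (α := Fin K)) (Sum.inr ∘ anc) K := by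
  rintro (⟨i, hi⟩ | ⟨n, hn, hna⟩)
  · exact Sum.inl_ne_inr hi
  obtain rfl := Sum.inr_injective hna
  rw [mem_map_nodeCCZ] at hccz
  rw [Set.mem_ofPred_eq] at hn
  by_cases hcase : 2 ≤ n ∧ n < 2 * K ∨ 2 * K < n ∧ n < 3 * K
  · obtain ⟨i, hi, k, rfl⟩ := exists_cczIndex_eq hcase
    exact hccz ⟨i, hi, k, rfl⟩
  · rcases eq_or_ne n 1 with rfl | hn1
    · exact h₁ rfl
    · refine hcopies (Finset.mem_image.2 ⟨n - 3 * K, Finset.mem_Ico.2 (by omega), ?_⟩)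
      rw [show 3 * K + (n - 3 * K) = n by omega]

/-- The circuit that evaluates the tree, with one CCZ state at each internal node. -/
def treeCircuit (hK : 2 ≤ K) : Circuit K A where
  numCCZ := K - 1
  ccz := nodeCCZ hanc
  plus := {anc 1}
  ops := circuitOps .inl (.inr ∘ anc) (Nat.clog 2 K)
  corr i := bit .sign (K + i)
  writes_nodup := nodup_writes_circuitOps (Sum.inr_injective.comp_injOn hanc) (by omega)
    (Nat.clog_pos one_lt_two hK) (Nat.le_pow_clog one_lt_two K)
  merge_disjoint := nodup_qubits_circuitOps Sum.inl_injective (Sum.inr_injective.comp_injOn hanc)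
    (fun _ _ => Sum.inl_ne_inr) (Nat.clog_pos one_lt_two hK)

variable (hK : 2 ≤ K)

theorem addressesDataForOneCycle_treeCircuit :
    (treeCircuit hanc hK).AddressesDataForOneCycle := by
  obtain ⟨ms, post, h, hpost⟩ := exists_circuitOps_eq_merge_cons (Sum.inl (α := Fin K))
    (Sum.inr ∘ anc) (Nat.clog_pos one_lt_two hK)
  refine ⟨[], ms, post, h, fun o ho i hi => ?_⟩
  obtain ⟨n, hn⟩ := hpost o ho _ hi
  exact Sum.inr_ne_inl hn

theorem cycles_treeCircuit (nP : ℕ) :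
    (treeCircuit hanc hK).cycles nP = nP + 4 * Nat.clog 2 K :=
  cycles_circuitOps (Nat.clog_pos one_lt_two hK) nP

theorem size_treeCircuit_le : (treeCircuit hanc hK).size ≤ 27 * K :=
  size_circuitOps_le (Sum.inr_injective.comp_injOn hanc) (by omega)
    (Nat.clog_pos one_lt_two hK) (Nat.le_pow_clog one_lt_two K)

theorem exists_ancillaState_treeCircuit_eq :
    ∃ R : State (Fin K ⊕ Fin A), DependsOn R (upLive .inl (.inr ∘ anc) K)ᶜ ∧ ∀ z,
      (treeCircuit hanc hK).ancillaState (z ∘ .inr) =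
        R z * ∏ j ∈ Finset.Ico 1 K, nodeAmp K (.inr ∘ anc) j z := by
  refine ⟨fun z => (1 / (Real.sqrt 8 : ℂ)) ^ (K - 1) *
    ∏ a ∈ (Finset.univ.map (nodeCCZ hanc))ᶜ \ copies K anc, spareAmp (anc 1) a (z ∘ .inr),
    fun z z' h => ?_, fun z => ?_⟩
  · refine congrArg _ (Finset.prod_congr rfl fun a ha => ?_)
    rw [Finset.mem_sdiff, Finset.mem_compl] at ha
    rcases eq_or_ne a (anc 1) with rfl | ha1
    · simp only [spareAmp, Finset.mem_singleton_self, if_true]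
    · rw [spareAmp, spareAmp, Function.comp_apply, Function.comp_apply,
        h _ (inr_notMem_upLive hanc ha1 ha.1 ha.2)]
  · have hstate : (treeCircuit hanc hK).ancillaState (z ∘ .inr) = _ :=
      congrArg (· * ∏ a ∈ (Finset.univ.map (nodeCCZ hanc))ᶜ, spareAmp (anc 1) a (z ∘ .inr))
        (prod_cczAmp_nodeCCZ hanc (z ∘ .inr))
    simp only [hstate, ← Finset.prod_sdiff (copies_subset_compl_map_nodeCCZ hanc),
      prod_copies_spareAmp hanc, nodeAmp, Finset.prod_mul_distrib, Function.comp_apply]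
    ring

theorem run_treeCircuit (γ : ℝ) (ω : ℕ → Bool) (ψ : State (Fin K)) :
    (treeCircuit hanc hK).run γ ω ψ =
      (execState γ ω (circuitProgram .inl (.inr ∘ anc)) (fun _ => false)
        (tensor ψ (treeCircuit hanc hK).ancillaState),
        execMemory ω (circuitProgram (Sum.inl (α := Fin K)) (Sum.inr ∘ anc)) fun _ => false) := by
  have h : Reorders (treeCircuit hanc hK).ops (circuitProgram .inl (.inr ∘ anc)) :=
    circuitOps_reorders (Sum.inr_injective.comp_injOn hanc) (by omega)
      (Nat.clog_pos one_lt_two hK) (Nat.le_pow_clog one_lt_two K)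
  rw [Circuit.run, foldl_run_eq, h.execState, h.execMemory]

theorem zEquivalent_treeCircuit (γ : ℝ) :
    (treeCircuit hanc hK).ZEquivalent γ (phaseGate K γ) := by
  intro ω
  obtain ⟨R, hR, hstart⟩ := exists_ancillaState_treeCircuit_eq hanc hK
  obtain ⟨R', hR', hend⟩ := exists_execState_circuitProgram γ ω
    (Sum.inr_injective.comp_injOn hanc) (fun _ _ => Sum.inl_ne_inr) (by omega) hR
  refine ⟨fun y => R' (Sum.elim (fun _ => false) y), fun ψ => funext fun z => ?_⟩
  have hR'z : R' z = R' (Sum.elim (fun _ => false) (z ∘ .inr)) := hR' fun q hq => by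
    cases q with
    | inl i => exact absurd ⟨i, rfl⟩ hq
    | inr a => rfl
  have hinit : tensor ψ (treeCircuit hanc hK).ancillaState = fun z : Fin K ⊕ Fin A → Bool =>
      ψ (z ∘ .inl) * R z * ∏ j ∈ Finset.Ico 1 K, nodeAmp K (.inr ∘ anc) j z := by
    funext z
    rw [mul_assoc, ← hstart]
    rfl
  let s (i : Fin K) : ℂ := sgn (execMemory ω (circuitProgram (Sum.inl (α := Fin K)) (Sum.inr ∘ anc))
    (fun _ => false) (bit .sign (K + i)) && z (.inl i))
  calc (treeCircuit hanc hK).correctedOutput γ ω ψ z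
    _ = (∏ i, s i) * ((phaseGate K γ).mulVec ψ (z ∘ .inl) * R' z * ∏ i, s i) := by
        rw [Circuit.correctedOutput, run_treeCircuit, hinit, hend]
        rfl
    _ = (phaseGate K γ).mulVec ψ (z ∘ .inl) * R' z := by
        rw [mul_left_comm, ← Finset.prod_mul_distrib]
        simp only [s, sgn_mul_self, Finset.prod_const_one, mul_one]
    _ = tensor ((phaseGate K γ).mulVec ψ) (fun y => R' (Sum.elim (fun _ => false) y)) z := by
        rw [hR'z]
        rfl

end Assembly

/-! ### Counting the CCZ states -/

theorem ceil_div_two_pow_succ (K n : ℕ) :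
    ⌈(K : ℚ) / 2 ^ (n + 1)⌉₊ = (⌈(K : ℚ) / 2 ^ n⌉₊ + 1) / 2 := by
  refine eq_of_forall_ge_iff fun m => ?_
  have h : (⌈(K : ℚ) / 2 ^ n⌉₊ + 1) / 2 ≤ m ↔ ⌈(K : ℚ) / 2 ^ n⌉₊ ≤ 2 * m := by omega
  rw [h, Nat.ceil_le, Nat.ceil_le, pow_succ, ← div_div, div_le_iff₀ (by norm_num)]
  push_cast
  rw [mul_comm]

theorem sum_half_ceil_add (K n : ℕ) :
    ∑ ℓ ∈ Finset.Icc 1 n, ⌈(K : ℚ) / 2 ^ (ℓ - 1)⌉₊ / 2 + ⌈(K : ℚ) / 2 ^ n⌉₊ = K := by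
  induction n with
  | zero => simp
  | succ n ih =>
    rw [Finset.sum_Icc_succ_top (by omega), ceil_div_two_pow_succ, Nat.add_sub_cancel]
    omega

theorem sum_half_ceil {K : ℕ} (hK : 1 ≤ K) :
    ∑ ℓ ∈ Finset.Icc 1 (Nat.clog 2 K), ⌈(K : ℚ) / 2 ^ (ℓ - 1)⌉₊ / 2 = K - 1 := by
  have h := sum_half_ceil_add K (Nat.clog 2 K)
  have h₁ : ⌈(K : ℚ) / 2 ^ Nat.clog 2 K⌉₊ = 1 := by
    refine le_antisymm (Nat.ceil_le.2 ?_) (Nat.ceil_pos.2 (by positivity))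
    rw [Nat.cast_one, div_le_one (by positivity)]
    exact_mod_cast Nat.le_pow_clog (by norm_num) K
  omega

theorem sum_two_pow_div (L : ℕ) : ∑ ℓ ∈ Finset.Icc 1 L, 2 ^ L / 2 ^ ℓ = 2 ^ L - 1 := by
  rw [← Finset.Ico_add_one_right_eq_Icc, Finset.sum_Ico_eq_sum_range, Nat.add_sub_cancel]
  induction L with
  | zero => simp
  | succ L ih =>
    have hshift (i : ℕ) : 2 ^ (L + 1) / 2 ^ (1 + (i + 1)) = 2 ^ L / 2 ^ (1 + i) := by
      rw [← add_assoc, pow_succ 2 L, pow_succ 2 (1 + i), Nat.mul_div_mul_right _ _ two_pos]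
    rw [Finset.sum_range_succ', Finset.sum_congr rfl fun i _ => hshift i, ih, add_zero, pow_one,
      pow_succ, Nat.mul_div_cancel _ two_pos]
    have := Nat.one_le_two_pow (n := L)
    omega

end LatticeSurgery

theorem mainTheorem1_general {K A : ℕ} (hK : 2 ≤ K) (hA : 4 * K ≤ A) :
    ∃ V : LatticeSurgery.Circuit K A,
      (∀ γ : ℝ, V.ZEquivalent γ (LatticeSurgery.phaseGate K γ)) ∧
      V.AddressesDataForOneCycle ∧
      V.numCCZ = ∑ ℓ ∈ Finset.Icc 1 (Nat.clog 2 K), ⌈(K : ℚ) / 2 ^ (ℓ - 1)⌉₊ / 2 ∧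
      V.numCCZ = K - 1 ∧
      (∀ L : ℕ, K = 2 ^ L → V.numCCZ = ∑ ℓ ∈ Finset.Icc 1 (Nat.clog 2 K), K / 2 ^ ℓ) ∧
      (∀ nP : ℕ, V.cycles nP = nP + 4 * Nat.clog 2 K) ∧
      V.size ≤ 27 * K := by
  let anc (n : ℕ) : Fin A := ⟨n % A, Nat.mod_lt _ (by omega)⟩
  have hanc : Set.InjOn anc (Set.Iio (4 * K)) := fun i hi j hj h => by
    rw [Set.mem_Iio] at hi hj
    simpa only [anc, Fin.mk.injEq, Nat.mod_eq_of_lt (hi.trans_le hA),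
      Nat.mod_eq_of_lt (hj.trans_le hA)] using h
  exact ⟨LatticeSurgery.treeCircuit hanc hK, LatticeSurgery.zEquivalent_treeCircuit hanc hK,
    LatticeSurgery.addressesDataForOneCycle_treeCircuit hanc hK,
    (LatticeSurgery.sum_half_ceil (by omega)).symm, rfl,
    fun L hL => by
      subst hL
      rw [Nat.clog_pow 2 L one_lt_two, LatticeSurgery.sum_two_pow_div]
      rfl,
    LatticeSurgery.cycles_treeCircuit hanc hK, LatticeSurgery.size_treeCircuit_le hanc hK⟩

theorem mainTheorem1 :
    ∃ p : Polynomial ℕ, ∀ K : ℕ, 2 ≤ K →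
      ∃ V : LatticeSurgery.Circuit K (13 * K / 2),
        (∀ γ : ℝ, V.ZEquivalent γ (LatticeSurgery.phaseGate K γ)) ∧
        V.AddressesDataForOneCycle ∧
        V.numCCZ = ∑ ℓ ∈ Finset.Icc 1 (Nat.clog 2 K), ⌈(K : ℚ) / 2 ^ (ℓ - 1)⌉₊ / 2 ∧
        V.numCCZ = K - 1 ∧
        (∀ L : ℕ, K = 2 ^ L → V.numCCZ = ∑ ℓ ∈ Finset.Icc 1 (Nat.clog 2 K), K / 2 ^ ℓ) ∧
        (∀ nP : ℕ, V.cycles nP = nP + 4 * Nat.clog 2 K) ∧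
        V.size ≤ p.eval K := by
  refine ⟨27 * Polynomial.X, fun K hK => ?_⟩
  simpa using mainTheorem1_general hK (show 4 * K ≤ 13 * K / 2 by omega)
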